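/- **Theorem 6.1 (Multiplication formula).** Let $(U_k)_{k\ge 0}$ be i.i.d. random variables, uniformly distributed on $[-1,1]$, and let $Y_t=\sum_{k\ge 0}\mathbf 1_{[2k+1+U_k,\infty)}(t)$, $t\in\mathbb R_+=[0,\infty)$. For $n\ge 0$ let $$\Delta_n=\bigcup_{k_1,\dots,k_n\ge 0\ \text{pairwise distinct}}[2k_1,2k_1+2]\times\cdots\times[2k_n,2k_n+2],$$ and let $\hat L^2(\mathbb R_+^n)$ be the space of symmetric functions in $L^2(\mathbb R_+^n)$ that vanish outside $\Delta_n$ (almost everywhere). For $f_n\in L^1(\mathbb R_+^n)\cap\hat L^2(\mathbb R_+^n)$ the multiple stochastic integral with respect to $d(Y_t-t/2)$ is $$I_n(f_n)=\sum_{r=0}^n\frac{(-1)^{n-r}}{2^{n-r}}\binom nr\sum_{k_1,\dots,k_r\ge 0\ \text{pairwise distinct}}\int_{\mathbb R_+^{n-r}}f_n(2k_1+1+U_{k_1},\dots,2k_r+1+U_{k_r},y_1,\dots,y_{n-r})\,dy_1\cdots dy_{n-r},$$ (so $I_0(c)=c$), and $I_n$ is extended by $L^2$-continuity to $\hat L^2(\mathbb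 R_+^n)$, with values in $L^2(\Omega)$. For a symmetric $h\in L^2(\mathbb R_+^p)$ that need not vanish outside $\Delta_p$, $I_p(h)$ stands for $I_p(h\mathbf 1_{\Delta_p})$. Let $n,m\ge 0$, and let $f_n\in\hat L^2(\mathbb R_+^n)$ and $g_m\in\hat L^2(\mathbb R_+^m)$ be canonical, i.e. $\int_{2k}^{2k+2}f_n(t,*)\,dt=0$ for all $k\in\mathbb N=\{0,1,\dots\}$ and almost every $*\in\mathbb R_+^{n-1}$, and likewise for $g_m$ (no condition if $n=0$, resp. $m=0$). For $0\le i\le k\le m\wedge n$ put $$f_n\star_k^i g_m(\gamma_1,\dots,\gamma_{k-i},t_1,\dots,t_{n-k},s_1,\dots,s_{m-k})=\frac1{2^i}\int_{[0,\infty)^i}f_n(z_1,\dots,z_i,\gamma_1,\dots,\gamma_{k-i},t_1,\dots,t_{n-k})\,g_m(z_1,\dots,z_i,\gamma_1,\dots,\gamma_{k-i},s_1,\dots,s_{m-k})\,dz_1\cdots dz_i,$$ and let $f_n\,\widetilde\star_k^i\,g_m$ be its symmetrisation in its $m+n-k-i$ variables (the average over all permutations of the variables). Assume that $f_n\star_k^i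 g_m\in L^2(\mathbb R_+^{m+n-k-i})$ for all $0\le i\le k\le m\wedge n$. Then all the multiple integrals below are well defined and, almost surely, $$I_n(f_n)\,I_m(g_m)=\sum_{k=0}^{m\wedge n}k!\binom mk\binom nk\sum_{i=0}^k\binom ki\,I_{m+n-k-i}\big(f_n\,\widetilde\star_k^i\,g_m\big).$$ -/

import Mathlib

open MeasureTheory ProbabilityTheory Filter Topology
open scoped ENNReal Nat

noncomputable section

namespace UniformChaos

/-- Lebesgue measure on `ℝ₊ⁿ = [0,∞)ⁿ`, as a measure on `Fin n → ℝ`.  For `n = 0` it is the unit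
mass at the only point of `ℝ⁰`. -/
def leb (n : ℕ) : Measure (Fin n → ℝ) :=
  Measure.pi fun _ : Fin n => (volume : Measure ℝ).restrict (Set.Ici 0)

/-- The `U k`, `k = 0, 1, 2, …`, are independent random variables, each uniformly distributed
on the interval `[-1, 1]`. -/
structure IsIIDUniform {Ω : Type*} [MeasurableSpace Ω] (P : Measure Ω) (U : ℕ → Ω → ℝ) :
    Prop where
  measurable : ∀ k, Measurable (U k)
  uniform : ∀ k, pdf.IsUniform (U k) (Set.Icc (-1) 1) P volume
  indep : iIndepFun U P

/-- The jump times `2k + 1 + U_k` of the point process `Y_t = ∑ₖ 1_{[2k+1+U_k, ∞)}(t)`. -/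
def jumpTime {Ω : Type*} (U : ℕ → Ω → ℝ) (k : ℕ) (ω : Ω) : ℝ := 2 * (k : ℝ) + 1 + U k ω

/-- `Δₙ`: the union of the boxes `[2k₁, 2k₁+2] × ⋯ × [2kₙ, 2kₙ+2]` over pairwise distinct
`k₁, …, kₙ ≥ 0`. -/
def offDiag (n : ℕ) : Set (Fin n → ℝ) :=
  {x | ∃ κ : Fin n → ℕ, Function.Injective κ ∧
    ∀ j, x j ∈ Set.Icc (2 * (κ j : ℝ)) (2 * (κ j : ℝ) + 2)}

/-- The space `L̂²(ℝ₊ⁿ)` of symmetric square integrable functions vanishing outside of `Δₙ`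
(functions being considered up to null sets). -/
structure MemHatL2 (n : ℕ) (f : (Fin n → ℝ) → ℝ) : Prop where
  memLp : MemLp f 2 (leb n)
  symmetric : ∀ σ : Equiv.Perm (Fin n), ∀ᵐ x ∂leb n, f (fun j => x (σ j)) = f x
  vanish : ∀ᵐ x ∂leb n, x ∉ offDiag n → f x = 0

/-- Canonical functions: `∫_{2k}^{2k+2} f(t, *) dt = 0` for every `k ∈ ℕ` and almost every `*`;
there is no condition on constants (`n = 0`). -/
def IsCanonical : (n : ℕ) → ((Fin n → ℝ) → ℝ) → Prop
  | 0, _ => True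
  | n + 1, f => ∀ k : ℕ, ∀ᵐ x ∂leb n,
      ∫ t in (2 * (k : ℝ))..(2 * (k : ℝ) + 2), f (Fin.cons t x : Fin (n + 1) → ℝ) = 0

/-- The multiple stochastic integral of `f ∈ L¹ ∩ L̂²(ℝ₊ⁿ)`, given by the explicit formula
`∑ᵣ (-1)ⁿ⁻ʳ/2ⁿ⁻ʳ C(n,r) ∑_{k₁,…,kᵣ distinct} ∫ f(2k₁+1+U_{k₁}, …, 2kᵣ+1+U_{kᵣ}, y) dy`,
with `y` ranging over `ℝ₊ⁿ⁻ʳ`. -/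
def elemIntegral {Ω : Type*} (U : ℕ → Ω → ℝ) (n : ℕ) (f : (Fin n → ℝ) → ℝ) (ω : Ω) : ℝ :=
  ∑ r ∈ Finset.range (n + 1),
    (-1 : ℝ) ^ (n - r) / 2 ^ (n - r) * (n.choose r : ℝ) *
      ∑' κ : Fin r ↪ ℕ, ∫ y : Fin (n - r) → ℝ,
        f (fun j : Fin n =>
          if h : (j : ℕ) < r then jumpTime U (κ ⟨j, h⟩) ω
          else y ⟨(j : ℕ) - r, by omega⟩) ∂leb (n - r)

/-- `Z ∈ L²(Ω)` is the value at `f` of the extension by `L²`-continuity of the multiple stochastic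
integral from `L¹ ∩ L̂²(ℝ₊ⁿ)` to its `L²`-closure `L̂²(ℝ₊ⁿ)`: `f` can be approximated by elements
`h` of `L¹ ∩ L̂²`, and the integrals of `h` tend to `Z` in `L²(Ω)` as `h` tends to `f`. -/
structure IsMultipleIntegral {Ω : Type*} [MeasurableSpace Ω] (P : Measure Ω) (U : ℕ → Ω → ℝ)
    (n : ℕ) (f : (Fin n → ℝ) → ℝ) (Z : Ω → ℝ) : Prop where
  memLp : MemLp Z 2 P
  approx : ∀ δ : ℝ≥0∞, 0 < δ → ∃ h : (Fin n → ℝ) → ℝ, MemHatL2 n h ∧ Integrable h (leb n) ∧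
    eLpNorm (h - f) 2 (leb n) ≤ δ
  tendsto : ∀ ε : ℝ≥0∞, 0 < ε → ∃ δ : ℝ≥0∞, 0 < δ ∧
    ∀ h : (Fin n → ℝ) → ℝ, MemHatL2 n h → Integrable h (leb n) →
      eLpNorm (h - f) 2 (leb n) ≤ δ → eLpNorm (elemIntegral U n h - Z) 2 P ≤ ε

open Classical in
/-- The multiple stochastic integral `Iₙ(f)` of `f ∈ L̂²(ℝ₊ⁿ)`, a square integrable random variable
(determined up to almost sure equality). -/
def multipleIntegral {Ω : Type*} [MeasurableSpace Ω] (P : Measure Ω) (U : ℕ → Ω → ℝ)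
    (n : ℕ) (f : (Fin n → ℝ) → ℝ) : Ω → ℝ :=
  if h : ∃ Z, IsMultipleIntegral P U n f Z then h.choose else 0

/-- The coordinate of `x` with (zero-based) index `j`; the value `0` for `j ≥ N` is never used
below. -/
def coord {N : ℕ} (x : Fin N → ℝ) (j : ℕ) : ℝ := if h : j < N then x ⟨j, h⟩ else 0

/-- The contraction `f ⋆ₖⁱ g` for `0 ≤ i ≤ k ≤ m ∧ n`.  The variable `x` is
`(γ₁,…,γ_{k-i}, t₁,…,t_{n-k}, s₁,…,s_{m-k})`, and the value is
`2⁻ⁱ ∫ f(z, γ, t) g(z, γ, s) dz` with `z` ranging over `[0,∞)ⁱ`. -/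
def contraction (n m k i : ℕ) (f : (Fin n → ℝ) → ℝ) (g : (Fin m → ℝ) → ℝ)
    (x : Fin (m + n - k - i) → ℝ) : ℝ :=
  1 / 2 ^ i * ∫ z : Fin i → ℝ,
    f (fun j : Fin n => if (j : ℕ) < i then coord z j else coord x (j - i)) *
    g (fun j : Fin m =>
      if (j : ℕ) < i then coord z j
      else if (j : ℕ) < k then coord x (j - i)
      else coord x ((n - i) + (j - k))) ∂leb i

/-- The symmetrisation of a function of `N` variables. -/
def symmetrisation (N : ℕ) (h : (Fin N → ℝ) → ℝ) (x : Fin N → ℝ) : ℝ :=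
  1 / (N ! : ℝ) * ∑ σ : Equiv.Perm (Fin N), h (fun j => x (σ j))

/-- The kernel of the integral of order `m + n - k - i`: the symmetrised contraction of `f` and
`g`, restricted to `Δ_{m+n-k-i}` so that it belongs to the domain of the multiple integral. -/
def productKernel (n m k i : ℕ) (f : (Fin n → ℝ) → ℝ) (g : (Fin m → ℝ) → ℝ) :
    (Fin (m + n - k - i) → ℝ) → ℝ :=
  (offDiag (m + n - k - i)).indicator
    (symmetrisation (m + n - k - i) (contraction n m k i f g))

end UniformChaos

end

/-!
Almost surely, `Iₙ(f) = n! Σ_B h_B`, where `B` runs through the sets of `n` jump indices and `h_B`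
is the Hoeffding component, centered in each of the jump times with index in `B`, of `f` evaluated
at these jump times. So all multiple integrals are functions of the path of independent jump times,
and two square integrable functions of the path agree as soon as they have the same integrals
against all products `∏_{k ∈ S} ψₖ(xₖ)` of bounded centered functions.

For `Iₙ(f) Iₘ(g)` this turns the claim into an identity between finite combinatorial sums. The pair
of index sets `A` of `f` and `B` of `g` contributes only if every index of `S` lies in `A ∪ B` and
every index outside `S` lies in both or in neither, so that the left-hand side becomes a sum over
the coverings `S = V ∪ W` and the sets `Z` disjoint from `S` of shared indices that are integrated
out. The contraction `f ⋆ₖⁱ g` sees exactly the terms with `|V ∩ W| = k - i` and `|Z| = i`: its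
factor `2⁻ⁱ` makes the Lebesgue integral over a box an average, and the canonicity of `f` and `g`
removes the centering. The numbers of orderings of `V`, `W` and `Z` account for the binomial
coefficients.
-/

noncomputable section

namespace UniformChaos

/-! ### Resampling and centering on product spaces -/

lemma sum_powerset_neg_one_pow_mul_insert {ι : Type*} [DecidableEq ι] {k : ι} {B : Finset ι}
    (hk : k ∈ B) (a : Finset ι → ℝ) :
    ∑ A ∈ B.powerset, (-1 : ℝ) ^ A.card * a (insert k A) = 0 := by
  obtain ⟨C, hkC, rfl⟩ : ∃ C, k ∉ C ∧ insert k C = B :=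
    ⟨B.erase k, Finset.notMem_erase _ _, Finset.insert_erase hk⟩
  rw [Finset.sum_powerset_insert hkC, ← Finset.sum_add_distrib]
  refine Finset.sum_eq_zero fun A hA => ?_
  have hkA : k ∉ A := fun h => hkC (Finset.mem_powerset.1 hA h)
  rw [Finset.card_insert_of_notMem hkA, Finset.insert_idem]
  ring

section ProductMeasure

open MeasureTheory.Measure (infinitePi)

lemma eLpNorm_integral_le_eLpNorm_prod {α β : Type*} [MeasurableSpace α] [MeasurableSpace β]
    {ρ : Measure α} {ν : Measure β} [IsProbabilityMeasure ν] {F : α × β → ℝ}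
    (hF : AEStronglyMeasurable F (ρ.prod ν)) {p : ℝ≥0∞} (hp : 1 ≤ p) (hp' : p ≠ ∞) :
    eLpNorm (fun x => ∫ y, F (x, y) ∂ν) p ρ ≤ eLpNorm F p (ρ.prod ν) := by
  have hp0 : p ≠ 0 := (zero_lt_one.trans_le hp).ne'
  have hpos : 0 < p.toReal := ENNReal.toReal_pos hp0 hp'
  rw [eLpNorm_eq_lintegral_rpow_enorm_toReal hp0 hp',
    eLpNorm_eq_lintegral_rpow_enorm_toReal hp0 hp', lintegral_prod _ (hF.enorm.pow_const _)]
  refine ENNReal.rpow_le_rpow (lintegral_mono_ae ?_) (by positivity)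
  filter_upwards [hF.prodMk_left] with x hx
  calc ‖∫ y, F (x, y) ∂ν‖ₑ ^ p.toReal
      ≤ (eLpNorm (fun y => F (x, y)) p ν) ^ p.toReal := by
        refine ENNReal.rpow_le_rpow ?_ hpos.le
        calc ‖∫ y, F (x, y) ∂ν‖ₑ ≤ eLpNorm (fun y => F (x, y)) 1 ν := by
              rw [eLpNorm_one_eq_lintegral_enorm]; exact enorm_integral_le_lintegral_enorm _
          _ ≤ eLpNorm (fun y => F (x, y)) p ν := eLpNorm_le_eLpNorm_of_exponent_le hp hx
    _ = ∫⁻ y, ‖F (x, y)‖ₑ ^ p.toReal ∂ν := by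
        rw [eLpNorm_eq_lintegral_rpow_enorm_toReal hp0 hp', ← ENNReal.rpow_mul,
          one_div_mul_cancel hpos.ne', ENNReal.rpow_one]

lemma measurePreserving_sumElim {α β E : Type*} [MeasurableSpace E] (ν : α → Measure E)
    (ρ : β → Measure E) [∀ a, IsProbabilityMeasure (ν a)] [∀ b, IsProbabilityMeasure (ρ b)] :
    MeasurePreserving (fun p : (α → E) × (β → E) => (Sum.elim p.1 p.2 : α ⊕ β → E))
      ((infinitePi ν).prod (infinitePi ρ)) (infinitePi (Sum.elim ν ρ)) := by
  have isProbabilityMeasure_elim (c : α ⊕ β) : IsProbabilityMeasure (Sum.elim ν ρ c) := by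
    rcases c with a | b <;> simp only [Sum.elim_inl, Sum.elim_inr] <;> infer_instance
  have measurable_elim :
      Measurable (fun p : (α → E) × (β → E) => (Sum.elim p.1 p.2 : α ⊕ β → E)) := by
    refine measurable_pi_iff.2 fun c => ?_
    rcases c with a | b <;> simp only [Sum.elim_inl, Sum.elim_inr] <;> fun_prop
  refine ⟨measurable_elim, Measure.eq_infinitePi _ fun s t ht => ?_⟩
  have preimage_pi : (fun p : (α → E) × (β → E) => (Sum.elim p.1 p.2 : α ⊕ β → E)) ⁻¹'
      (Set.pi (s : Set (α ⊕ β)) t) =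
      (Set.pi (s.toLeft : Set α) fun a => t (Sum.inl a)) ×ˢ
        (Set.pi (s.toRight : Set β) fun b => t (Sum.inr b)) := by
    ext p
    simp [Set.mem_pi]
  rw [Measure.map_apply measurable_elim (MeasurableSet.pi s.countable_toSet fun i _ => ht i),
    preimage_pi, Measure.prod_prod, Measure.infinitePi_pi _ fun _ _ => ht _,
    Measure.infinitePi_pi _ fun _ _ => ht _]
  conv_rhs => rw [← Finset.toLeft_disjSum_toRight (u := s), Finset.prod_disjSum]
  rfl

variable {ι : Type*} {X : ι → Type*} {F G : (∀ i, X i) → ℝ} {ψ : ∀ i, X i → ℝ}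

/-- The test function `∏ k ∈ S, ψ k` on paths. -/
def testFn (ψ : ∀ i, X i → ℝ) (S : Finset ι) (x : ∀ i, X i) : ℝ := ∏ i ∈ S, ψ i (x i)

lemma dependsOn_testFn (ψ : ∀ i, X i → ℝ) (S : Finset ι) : DependsOn (testFn ψ S) (S : Set ι) :=
  fun _ _ h => Finset.prod_congr rfl fun i hi => by rw [h i hi]

variable [∀ i, MeasurableSpace (X i)] {μ : ∀ i, Measure (X i)}

variable (μ) in
/-- Functions of the coordinates, bounded by `1` and of mean zero; the products of finitely many of
them are the test functions against which random variables are identified. -/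
structure IsTest (ψ : ∀ i, X i → ℝ) : Prop where
  measurable : ∀ i, Measurable (ψ i)
  bounded : ∀ i t, |ψ i t| ≤ 1
  centered : ∀ i, ∫ t, ψ i t ∂μ i = 0

lemma IsTest.measurable_testFn (hψ : IsTest μ ψ) (S : Finset ι) : Measurable (testFn ψ S) :=
  Finset.measurable_prod _ fun i _ => (hψ.measurable i).comp (measurable_pi_apply i)

lemma IsTest.norm_testFn_le (hψ : IsTest μ ψ) (S : Finset ι) (x : ∀ i, X i) :
    ‖testFn ψ S x‖ ≤ 1 := by
  rw [testFn, Real.norm_eq_abs, Finset.abs_prod]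
  exact Finset.prod_le_one (fun _ _ => abs_nonneg _) fun i _ => hψ.bounded i _

lemma IsTest.integrable_mul (hψ : IsTest μ ψ) (S : Finset ι) {ρ : Measure (∀ i, X i)}
    (hF : Integrable F ρ) : Integrable (fun x => F x * testFn ψ S x) ρ :=
  hF.mul_bdd (hψ.measurable_testFn S).aestronglyMeasurable
    (Eventually.of_forall (hψ.norm_testFn_le S))

section Resample

variable [DecidableEq ι]

variable (μ) in
/-- The conditional expectation of `F` given the coordinates outside of `A`, in the version that
integrates over independent copies of the coordinates in `A`. -/
def resample (A : Finset ι) (F : (∀ i, X i) → ℝ) (x : ∀ i, X i) : ℝ :=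
  ∫ y, F (A.piecewise y x) ∂infinitePi μ

variable (μ) in
/-- The conditional expectation of `F` given the coordinates other than `k` vanishes. -/
def IsCentered (k : ι) (F : (∀ i, X i) → ℝ) : Prop := resample μ {k} F =ᵐ[infinitePi μ] 0

variable (μ) in
/-- The part of `F` that is centered with respect to all the coordinates in `B`: the expansion of
`∏ k ∈ B, (1 - E[· | coordinates ≠ k])` applied to `F`, as in the Hoeffding decomposition. -/
def centerPart (B : Finset ι) (F : (∀ i, X i) → ℝ) (x : ∀ i, X i) : ℝ :=
  ∑ A ∈ B.powerset, (-1 : ℝ) ^ A.card * resample μ A F x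

lemma dependsOn_resample_compl (F : (∀ i, X i) → ℝ) (A : Finset ι) :
    DependsOn (resample μ A F) (A : Set ι)ᶜ := by
  intro x x' h
  have piecewise_eq (y : ∀ i, X i) : A.piecewise y x = A.piecewise y x' :=
    A.piecewise_congr (fun _ _ => rfl) h
  simp only [resample, piecewise_eq]

lemma dependsOn_resample {s : Set ι} (hF : DependsOn F s) (A : Finset ι) :
    DependsOn (resample μ A F) s := by
  intro x x' h
  refine integral_congr_ae (Eventually.of_forall fun y => hF fun k hk => ?_)
  by_cases hA : k ∈ A
  · simp [Finset.piecewise, hA]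
  · simp only [Finset.piecewise, hA, if_false]; exact h k hk

lemma dependsOn_centerPart {s : Set ι} (hF : DependsOn F s) (B : Finset ι) :
    DependsOn (centerPart μ B F) s :=
  fun _ _ h => Finset.sum_congr rfl fun A _ => by rw [dependsOn_resample hF A h]

end Resample

variable [∀ i, IsProbabilityMeasure (μ i)]

lemma integral_eval_infinitePi {k : ι} {u : X k → ℝ} (hu : AEStronglyMeasurable u (μ k)) :
    ∫ x, u (x k) ∂infinitePi μ = ∫ t, u t ∂μ k := by
  have hk := measurePreserving_eval_infinitePi μ k
  rw [← hk.map_eq] at hu ⊢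
  exact (integral_map hk.measurable.aemeasurable hu).symm

variable (μ) in
lemma isTest_indicator_sub {t : ∀ i, Set (X i)} (ht : ∀ i, MeasurableSet (t i)) :
    IsTest μ fun i s => (t i).indicator 1 s - (μ i).real (t i) where
  measurable i := (measurable_one.indicator (ht i)).sub_const _
  bounded i s := by
    have h0 : 0 ≤ (μ i).real (t i) := measureReal_nonneg
    have h1 : (μ i).real (t i) ≤ 1 := measureReal_le_one
    by_cases hs : s ∈ t i <;> simp only [hs, Set.indicator_of_mem, Set.indicator_of_notMem,
      not_false_eq_true, Pi.one_apply, abs_le] <;> constructor <;> linarith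
  centered i := by
    have indicator_integrable : Integrable ((t i).indicator (1 : X i → ℝ)) (μ i) :=
      (integrable_const (1 : ℝ)).indicator (ht i)
    rw [integral_sub indicator_integrable (integrable_const _)]
    simp [integral_indicator_one (ht i)]

lemma setIntegral_pi_eq_zero_of_testFn (hF : Integrable F (infinitePi μ))
    (h : ∀ ψ, IsTest μ ψ → ∀ S, ∫ x, F x * testFn ψ S x ∂infinitePi μ = 0) (S : Finset ι)
    {t : ∀ i, Set (X i)} (ht : ∀ i, MeasurableSet (t i)) :
    ∫ x in (S : Set ι).pi t, F x ∂infinitePi μ = 0 := by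
  classical
  set c : ι → ℝ := fun i => (μ i).real (t i)
  set ψ : ∀ i, X i → ℝ := fun i s => (t i).indicator 1 s - c i with hψ_def
  have hψ : IsTest μ ψ := isTest_indicator_sub μ ht
  have indicator_pi (x : ∀ i, X i) : ((S : Set ι).pi t).indicator F x =
      F x * ∏ i ∈ S, (ψ i (x i) + c i) := by
    simp only [hψ_def, sub_add_cancel]
    by_cases hx : x ∈ (S : Set ι).pi t
    · rw [Set.indicator_of_mem hx, Finset.prod_eq_one, mul_one]
      intro i hi
      rw [Set.indicator_of_mem (hx i hi), Pi.one_apply]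
    · rw [Set.indicator_of_notMem hx]
      simp only [Set.mem_pi, not_forall] at hx
      obtain ⟨i, hi, hit⟩ := hx
      rw [Finset.prod_eq_zero hi (Set.indicator_of_notMem hit _), mul_zero]
  have expand (x : ∀ i, X i) : ((S : Set ι).pi t).indicator F x =
      ∑ T ∈ S.powerset, (F x * testFn ψ T x) * ∏ i ∈ S \ T, c i := by
    rw [indicator_pi, Finset.prod_add, Finset.mul_sum]
    exact Finset.sum_congr rfl fun T _ => by rw [testFn, mul_assoc]
  rw [← integral_indicator (MeasurableSet.pi S.countable_toSet fun i _ => ht i)]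
  simp_rw [expand]
  rw [integral_finsetSum _ fun T _ => (hψ.integrable_mul T hF).mul_const _]
  exact Finset.sum_eq_zero fun T _ => by rw [integral_mul_const, h ψ hψ T, zero_mul]

lemma ae_eq_zero_of_testFn (hF : Integrable F (infinitePi μ))
    (h : ∀ ψ, IsTest μ ψ → ∀ S, ∫ x, F x * testFn ψ S x ∂infinitePi μ = 0) :
    F =ᵐ[infinitePi μ] 0 := by
  refine hF.ae_eq_zero_of_forall_setIntegral_eq_zero fun s hs _ => ?_
  induction s, hs using MeasurableSpace.induction_on_inter
    (generateFrom_squareCylinders (α := X)).symm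
    (isPiSystem_squareCylinders (fun _ => MeasurableSpace.isPiSystem_measurableSet)
      (fun _ => by simp)) with
  | empty => simp
  | basic t ht =>
    obtain ⟨S, u, hu, rfl⟩ := ht
    exact setIntegral_pi_eq_zero_of_testFn hF h S fun i => hu i trivial
  | compl t ht ih =>
    have integral_eq_zero : ∫ x, F x ∂infinitePi μ = 0 := by
      simpa using setIntegral_pi_eq_zero_of_testFn hF h ∅ fun _ => MeasurableSet.univ
    rwa [← integral_add_compl ht hF, ih (measure_lt_top _ _), zero_add] at integral_eq_zero
  | iUnion u hd hm ih =>
    rw [integral_iUnion hm hd hF.integrableOn]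
    simp [fun i => ih i (measure_lt_top _ _)]

variable [DecidableEq ι]

variable (μ) in
lemma measurePreserving_piecewise (A : Finset ι) :
    MeasurePreserving (fun p : (∀ i, X i) × (∀ i, X i) => A.piecewise p.2 p.1)
      ((infinitePi μ).prod (infinitePi μ)) (infinitePi μ) := by
  have measurable_piecewise :
      Measurable (fun p : (∀ i, X i) × (∀ i, X i) => A.piecewise p.2 p.1) := by
    refine measurable_pi_iff.2 fun k => ?_
    by_cases hk : k ∈ A
    · simp only [Finset.piecewise, hk, if_true]; fun_prop
    · simp only [Finset.piecewise, hk, if_false]; fun_prop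
  refine ⟨measurable_piecewise, Measure.eq_infinitePi _ fun s t ht => ?_⟩
  have preimage_pi : (fun p : (∀ i, X i) × (∀ i, X i) => A.piecewise p.2 p.1) ⁻¹'
      (Set.pi (s : Set ι) t) =
      (Set.pi ((s \ A : Finset ι) : Set ι) t) ×ˢ (Set.pi ((s ∩ A : Finset ι) : Set ι) t) := by
    ext ⟨x, y⟩
    simp only [Set.mem_preimage, Set.mem_pi, Set.mem_prod, Finset.mem_coe, Finset.mem_sdiff,
      Finset.mem_inter, Finset.piecewise]
    refine ⟨fun h => ⟨fun i hi => ?_, fun i hi => ?_⟩, fun h i hi => ?_⟩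
    · simpa [hi.2] using h i hi.1
    · simpa [hi.2] using h i hi.1
    · by_cases hA : i ∈ A
      · simpa [hA] using h.2 i ⟨hi, hA⟩
      · simpa [hA] using h.1 i ⟨hi, hA⟩
  rw [Measure.map_apply measurable_piecewise
      (MeasurableSet.pi s.countable_toSet fun i _ => ht i), preimage_pi, Measure.prod_prod,
    Measure.infinitePi_pi _ fun i _ => ht i, Measure.infinitePi_pi _ fun i _ => ht i, mul_comm,
    Finset.prod_inter_mul_prod_sdiff]

lemma ae_ae_piecewise {p : (∀ i, X i) → Prop} (h : ∀ᵐ x ∂infinitePi μ, p x) (A : Finset ι) :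
    ∀ᵐ x ∂infinitePi μ, ∀ᵐ y ∂infinitePi μ, p (A.piecewise y x) :=
  Measure.ae_ae_of_ae_prod ((measurePreserving_piecewise μ A).quasiMeasurePreserving.ae h)

lemma resample_congr (h : F =ᵐ[infinitePi μ] G) (A : Finset ι) :
    resample μ A F =ᵐ[infinitePi μ] resample μ A G := by
  filter_upwards [ae_ae_piecewise h A] with x hx
  exact integral_congr_ae hx

lemma resample_empty (F : (∀ i, X i) → ℝ) : resample μ ∅ F = F := by
  funext x; simp [resample]

lemma integrable_piecewise (hF : Integrable F (infinitePi μ)) (A : Finset ι) :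
    Integrable (fun p : (∀ i, X i) × (∀ i, X i) => F (A.piecewise p.2 p.1))
      ((infinitePi μ).prod (infinitePi μ)) :=
  (measurePreserving_piecewise μ A).integrable_comp_of_integrable hF

lemma ae_integrable_piecewise (hF : Integrable F (infinitePi μ)) (A : Finset ι) :
    ∀ᵐ x ∂infinitePi μ, Integrable (fun y => F (A.piecewise y x)) (infinitePi μ) :=
  (integrable_piecewise hF A).prod_right_ae

lemma integrable_resample (hF : Integrable F (infinitePi μ)) (A : Finset ι) :
    Integrable (resample μ A F) (infinitePi μ) :=
  (integrable_piecewise hF A).integral_prod_left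

lemma integral_resample (hF : Integrable F (infinitePi μ)) (A : Finset ι) :
    ∫ x, resample μ A F x ∂infinitePi μ = ∫ x, F x ∂infinitePi μ := by
  have hA := measurePreserving_piecewise μ A
  calc ∫ x, resample μ A F x ∂infinitePi μ
      = ∫ p, F (A.piecewise p.2 p.1) ∂((infinitePi μ).prod (infinitePi μ)) :=
        (integral_prod _ (integrable_piecewise hF A)).symm
    _ = ∫ x, F x ∂infinitePi μ := by
        conv_rhs => rw [← hA.map_eq]
        exact (integral_map hA.measurable.aemeasurable (hA.map_eq.symm ▸ hF.1)).symm

lemma resample_finsetSum {α : Type*} {s : Finset α} {H : α → (∀ i, X i) → ℝ} (c : α → ℝ)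
    (hH : ∀ a ∈ s, Integrable (H a) (infinitePi μ)) (A : Finset ι) :
    resample μ A (fun x => ∑ a ∈ s, c a * H a x) =ᵐ[infinitePi μ]
      fun x => ∑ a ∈ s, c a * resample μ A (H a) x := by
  filter_upwards [(Filter.eventually_all_finset s).2 fun a ha =>
    ae_integrable_piecewise (hH a ha) A] with x hx
  simp only [resample]
  rw [integral_finsetSum _ fun a ha => (hx a ha).const_mul _]
  simp only [integral_const_mul]

lemma resample_sub (hF : Integrable F (infinitePi μ)) (hG : Integrable G (infinitePi μ))
    (A : Finset ι) :
    resample μ A (F - G) =ᵐ[infinitePi μ] resample μ A F - resample μ A G := by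
  filter_upwards [ae_integrable_piecewise hF A, ae_integrable_piecewise hG A] with x hFx hGx
  exact integral_sub hFx hGx

lemma resample_resample (hF : Integrable F (infinitePi μ)) (A B : Finset ι) :
    resample μ A (resample μ B F) =ᵐ[infinitePi μ] resample μ (A ∪ B) F := by
  filter_upwards [ae_integrable_piecewise hF (A ∪ B)] with x hx
  have piecewise_union (y z : ∀ i, X i) :
      B.piecewise z (A.piecewise y x) = (A ∪ B).piecewise (B.piecewise z y) x := by
    funext k
    by_cases hA : k ∈ A <;> by_cases hB : k ∈ B <;> simp [Finset.piecewise, hA, hB]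
  calc resample μ A (resample μ B F) x
      = ∫ y, resample μ B (fun w => F ((A ∪ B).piecewise w x)) y ∂infinitePi μ := by
        simp only [resample, piecewise_union]
    _ = resample μ (A ∪ B) F x := integral_resample hx B

lemma resample_eq_zero (hF : Integrable F (infinitePi μ)) {k : ι} (hk : IsCentered μ k F)
    {A : Finset ι} (hA : k ∈ A) : resample μ A F =ᵐ[infinitePi μ] 0 :=
  calc resample μ A F = resample μ (A ∪ {k}) F := by
        rw [Finset.union_eq_left.2 (Finset.singleton_subset_iff.2 hA)]
    _ =ᵐ[infinitePi μ] resample μ A (resample μ {k} F) := (resample_resample hF A {k}).symm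
    _ =ᵐ[infinitePi μ] resample μ A 0 := resample_congr hk A
    _ = 0 := by funext x; simp [resample]

lemma resample_centerPart (hF : Integrable F (infinitePi μ)) (k : ι) (B : Finset ι) :
    resample μ {k} (centerPart μ B F) =ᵐ[infinitePi μ]
      fun x => ∑ A ∈ B.powerset, (-1 : ℝ) ^ A.card * resample μ (insert k A) F x := by
  filter_upwards [resample_finsetSum (fun A => (-1 : ℝ) ^ A.card)
      (fun A _ => integrable_resample hF A) {k},
    (Filter.eventually_all_finset B.powerset).2 fun A _ => resample_resample hF {k} A]
    with x resample_sum resample_insert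
  exact resample_sum.trans (Finset.sum_congr rfl fun A hA => by rw [resample_insert A hA]; rfl)

lemma isCentered_centerPart (hF : Integrable F (infinitePi μ)) {k : ι} {B : Finset ι}
    (hk : k ∈ B) : IsCentered μ k (centerPart μ B F) := by
  filter_upwards [resample_centerPart hF k B] with x hx
  exact hx.trans (sum_powerset_neg_one_pow_mul_insert hk fun A => resample μ A F x)

lemma centerPart_eq_self (hF : Integrable F (infinitePi μ)) {B : Finset ι}
    (h : ∀ k ∈ B, IsCentered μ k F) : centerPart μ B F =ᵐ[infinitePi μ] F := by
  have resample_vanishes : ∀ᵐ x ∂infinitePi μ, ∀ A ∈ B.powerset.erase ∅, resample μ A F x = 0 := by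
    refine (Filter.eventually_all_finset _).2 fun A hA => ?_
    obtain ⟨hA0, hAB⟩ := Finset.mem_erase.1 hA
    obtain ⟨k, hk⟩ := Finset.nonempty_iff_ne_empty.2 hA0
    exact resample_eq_zero hF (h k (Finset.mem_powerset.1 hAB hk)) hk
  filter_upwards [resample_vanishes] with x hx
  rw [centerPart, ← Finset.add_sum_erase _ _ (Finset.empty_mem_powerset B),
    Finset.sum_eq_zero fun A hA => by rw [hx A hA, mul_zero]]
  simp [resample_empty]

lemma integral_mul_eq_zero {k : ι} (hF : IsCentered μ k F) (hG : DependsOn G {k}ᶜ)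
    (hFG : Integrable (F * G) (infinitePi μ)) : ∫ x, F x * G x ∂infinitePi μ = 0 := by
  have resample_mul (x : ∀ i, X i) : resample μ {k} (F * G) x = resample μ {k} F x * G x := by
    simp only [resample, ← integral_mul_const, Pi.mul_apply]
    refine integral_congr_ae (Eventually.of_forall fun y =>
      congrArg (F (({k} : Finset ι).piecewise y x) * ·) ?_)
    exact hG fun j hj => Finset.piecewise_eq_of_notMem _ _ _ (by simpa using hj)
  calc ∫ x, F x * G x ∂infinitePi μ = ∫ x, resample μ {k} (F * G) x ∂infinitePi μ :=
        (integral_resample hFG {k}).symm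
    _ = 0 := by
        refine integral_eq_zero_of_ae ?_
        filter_upwards [hF] with x hx
        rw [resample_mul, hx, Pi.zero_apply, zero_mul]

lemma eLpNorm_resample_le (hF : AEStronglyMeasurable F (infinitePi μ)) {p : ℝ≥0∞} (hp : 1 ≤ p)
    (hp' : p ≠ ∞) (A : Finset ι) :
    eLpNorm (resample μ A F) p (infinitePi μ) ≤ eLpNorm F p (infinitePi μ) := by
  have hA := measurePreserving_piecewise μ A
  exact (eLpNorm_integral_le_eLpNorm_prod (hF.comp_measurePreserving hA) hp hp').trans_eq
    (eLpNorm_comp_measurePreserving hF hA)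

lemma memLp_resample {p : ℝ≥0∞} (hp : 1 ≤ p) (hp' : p ≠ ∞) (hF : MemLp F p (infinitePi μ))
    (A : Finset ι) : MemLp (resample μ A F) p (infinitePi μ) :=
  ⟨(integrable_resample (hF.integrable hp) A).1,
    (eLpNorm_resample_le hF.1 hp hp' A).trans_lt hF.2⟩

lemma memLp_centerPart {p : ℝ≥0∞} (hp : 1 ≤ p) (hp' : p ≠ ∞) (hF : MemLp F p (infinitePi μ))
    (B : Finset ι) : MemLp (centerPart μ B F) p (infinitePi μ) :=
  memLp_finsetSum _ fun A _ => (memLp_resample hp hp' hF A).const_mul _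

lemma centerPart_sub (hF : Integrable F (infinitePi μ)) (hG : Integrable G (infinitePi μ))
    (B : Finset ι) :
    centerPart μ B (F - G) =ᵐ[infinitePi μ] centerPart μ B F - centerPart μ B G := by
  filter_upwards [(Filter.eventually_all_finset B.powerset).2 fun A _ => resample_sub hF hG A]
    with x hx
  simp only [centerPart, Pi.sub_apply, ← Finset.sum_sub_distrib, ← mul_sub]
  exact Finset.sum_congr rfl fun A hA => by rw [hx A hA, Pi.sub_apply]

lemma eLpNorm_centerPart_le {p : ℝ≥0∞} (hp : 1 ≤ p) (hp' : p ≠ ∞)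
    (hF : MemLp F p (infinitePi μ)) (B : Finset ι) :
    eLpNorm (centerPart μ B F) p (infinitePi μ) ≤ 2 ^ B.card * eLpNorm F p (infinitePi μ) := by
  have centerPart_eq_sum :
      centerPart μ B F = ∑ A ∈ B.powerset, (-1 : ℝ) ^ A.card • resample μ A F := by
    funext x; simp [centerPart]
  calc eLpNorm (centerPart μ B F) p (infinitePi μ)
      ≤ ∑ A ∈ B.powerset, eLpNorm ((-1 : ℝ) ^ A.card • resample μ A F) p (infinitePi μ) := by
        rw [centerPart_eq_sum]
        exact eLpNorm_sum_le (fun A _ => ((memLp_resample hp hp' hF A).const_smul _).1) hp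
    _ ≤ ∑ _A ∈ B.powerset, eLpNorm F p (infinitePi μ) := by
        gcongr
        simpa [eLpNorm_const_smul] using eLpNorm_resample_le hF.1 hp hp' _
    _ = 2 ^ B.card * eLpNorm F p (infinitePi μ) := by simp

lemma IsTest.isCentered (hψ : IsTest μ ψ) {S : Finset ι} {k : ι} (hk : k ∈ S) :
    IsCentered μ k (testFn ψ S) := by
  refine Eventually.of_forall fun x => ?_
  have testFn_piecewise (y : ∀ i, X i) : testFn ψ S (({k} : Finset ι).piecewise y x) =
      ψ k (y k) * ∏ j ∈ S.erase k, ψ j (x j) := by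
    rw [testFn, ← Finset.mul_prod_erase _ _ hk, Finset.piecewise_singleton, Function.update_self]
    congr 1
    exact Finset.prod_congr rfl fun j hj => by
      rw [Function.update_of_ne (Finset.ne_of_mem_erase hj)]
  simp only [resample, testFn_piecewise, integral_mul_const, Pi.zero_apply]
  rw [integral_eval_infinitePi (hψ.measurable k).aestronglyMeasurable, hψ.centered, zero_mul]

lemma integral_centerPart_mul_testFn (hF : Integrable F (infinitePi μ)) (hψ : IsTest μ ψ)
    (B : Finset ι) :
    ∫ x, centerPart μ B F x * testFn ψ B x ∂infinitePi μ =
      ∫ x, F x * testFn ψ B x ∂infinitePi μ := by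
  have integral_resample_mul_eq_zero (A : Finset ι) (hA : A ∈ B.powerset) (hne : A ≠ ∅) :
      ∫ x, resample μ A F x * testFn ψ B x ∂infinitePi μ = 0 := by
    obtain ⟨k, hk⟩ := Finset.nonempty_iff_ne_empty.2 hne
    have integrable_mul := hψ.integrable_mul B (integrable_resample hF A)
    simp only [mul_comm (resample μ A F _)] at integrable_mul ⊢
    exact integral_mul_eq_zero (hψ.isCentered (Finset.mem_powerset.1 hA hk))
      ((dependsOn_resample_compl F A).mono (Set.compl_subset_compl.2 (by simpa using hk)))
      integrable_mul
  simp only [centerPart, Finset.sum_mul, mul_assoc]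
  rw [integral_finsetSum _ fun A _ =>
      (hψ.integrable_mul B (integrable_resample hF A)).const_mul _,
    Finset.sum_eq_single ∅ (fun A hA hne => by
      rw [integral_const_mul, integral_resample_mul_eq_zero A hA hne, mul_zero]) (by simp)]
  simp [resample_empty]

lemma integral_mul_mul_eq_zero {H : (∀ i, X i) → ℝ} {k : ι} (hF : IsCentered μ k F)
    (hG : DependsOn G {k}ᶜ) (hH : DependsOn H {k}ᶜ)
    (hFGH : Integrable (F * (G * H)) (infinitePi μ)) :
    ∫ x, F x * (G x * H x) ∂infinitePi μ = 0 :=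
  integral_mul_eq_zero hF (fun x x' h => by simp only [hG h, hH h]) hFGH

end ProductMeasure

/-! ### Jump times and boxes -/

instance (n : ℕ) : SigmaFinite (leb n) := by
  unfold leb; infer_instance

/-- The uniform distribution on the interval `[2k, 2k+2]`, the law of the jump time of index `k`. -/
def boxLaw (k : ℕ) : Measure ℝ :=
  (2 : ℝ≥0∞)⁻¹ • (volume : Measure ℝ).restrict (Set.Icc (2 * (k : ℝ)) (2 * (k : ℝ) + 2))

instance (k : ℕ) : IsProbabilityMeasure (boxLaw k) := by
  constructor
  rw [boxLaw, Measure.smul_apply, Measure.restrict_apply_univ, Real.volume_Icc,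
    add_sub_cancel_left, smul_eq_mul, ENNReal.ofReal_ofNat]
  exact ENNReal.inv_mul_cancel (by norm_num) (by norm_num)

/-- The law of the sequence of all jump times. -/
abbrev pathLaw : Measure (ℕ → ℝ) := Measure.infinitePi boxLaw

lemma two_smul_boxLaw (k : ℕ) :
    (2 : ℝ≥0∞) • boxLaw k =
      (volume : Measure ℝ).restrict (Set.Icc (2 * (k : ℝ)) (2 * (k : ℝ) + 2)) := by
  rw [boxLaw, smul_smul, ENNReal.mul_inv_cancel (by norm_num) (by norm_num), one_smul]

section JumpTime

variable {Ω : Type*} [MeasurableSpace Ω] {P : Measure Ω} {U : ℕ → Ω → ℝ}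

lemma map_jumpTime (hU : IsIIDUniform P U) (k : ℕ) : P.map (jumpTime U k) = boxLaw k := by
  have map_uniform : P.map (U k) = ProbabilityTheory.cond volume (Set.Icc (-1 : ℝ) 1) :=
    hU.uniform k
  have volume_Icc : (volume : Measure ℝ) (Set.Icc (-1) 1) = 2 := by
    rw [Real.volume_Icc]; norm_num
  have preimage_Icc : (fun x : ℝ => (2 * (k : ℝ) + 1) + x) ⁻¹'
      (Set.Icc (2 * (k : ℝ)) (2 * (k : ℝ) + 2)) = Set.Icc (-1) 1 := by
    rw [Set.preimage_const_add_Icc]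
    congr 1 <;> ring
  calc P.map (jumpTime U k) = (P.map (U k)).map (fun x : ℝ => (2 * (k : ℝ) + 1) + x) :=
        (Measure.map_map (by fun_prop) (hU.measurable k)).symm
    _ = boxLaw k := by
        rw [map_uniform, ProbabilityTheory.cond, Measure.map_smul, boxLaw, volume_Icc,
          ← preimage_Icc]
        exact congrArg _ ((measurePreserving_add_left volume (2 * (k : ℝ) + 1)).restrict_preimage
          measurableSet_Icc).map_eq

lemma measurePreserving_jumpTime [IsProbabilityMeasure P] (hU : IsIIDUniform P U) :
    MeasurePreserving (fun ω k => jumpTime U k ω) P pathLaw := by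
  have measurable_jumpTime (k : ℕ) : Measurable (jumpTime U k) := (hU.measurable k).const_add _
  have indep : iIndepFun (jumpTime U) P :=
    hU.indep.comp (fun k x => 2 * (k : ℝ) + 1 + x) (fun k => by fun_prop)
  refine ⟨measurable_pi_iff.2 measurable_jumpTime, ?_⟩
  rw [(iIndepFun_iff_map_fun_eq_infinitePi_map measurable_jumpTime).1 indep, pathLaw]
  simp_rw [map_jumpTime hU]

end JumpTime

lemma measurePreserving_comp {n : ℕ} {κ : Fin n → ℕ} (hκ : Function.Injective κ) :
    MeasurePreserving (fun (x : ℕ → ℝ) (j : Fin n) => x (κ j)) pathLaw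
      (Measure.pi fun j => boxLaw (κ j)) :=
  ⟨by fun_prop, by
    rw [pathLaw, Measure.map_infinitePi_infinitePi_of_inj hκ, Measure.infinitePi_eq_pi]⟩

/-- The box `∏ j, [2κ(j), 2κ(j)+2)`; the boxes are half-open, so that they are disjoint. -/
def box {n : ℕ} (κ : Fin n → ℕ) : Set (Fin n → ℝ) :=
  Set.pi Set.univ fun j => Set.Ico (2 * (κ j : ℝ)) (2 * (κ j : ℝ) + 2)

lemma measurableSet_box {n : ℕ} (κ : Fin n → ℕ) : MeasurableSet (box κ) :=
  MeasurableSet.univ_pi fun _ => measurableSet_Ico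

lemma pairwise_disjoint_box (n : ℕ) :
    Pairwise (Function.onFun Disjoint (box : (Fin n → ℕ) → Set (Fin n → ℝ))) := by
  intro κ κ' hne
  refine Set.disjoint_left.2 fun x hx hx' => hne (funext fun j => ?_)
  obtain ⟨lower, upper⟩ := hx j trivial
  obtain ⟨lower', upper'⟩ := hx' j trivial
  have : (κ j : ℝ) < κ' j + 1 := by linarith
  have : (κ' j : ℝ) < κ j + 1 := by linarith
  norm_cast at *
  omega

lemma ae_leb_nonneg_not_even (n : ℕ) :
    ∀ᵐ x ∂leb n, ∀ j, 0 ≤ x j ∧ ∀ k : ℕ, x j ≠ 2 * (k : ℝ) := by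
  refine ae_all_iff.2 fun j => ?_
  have ae_nonneg_not_even : ∀ᵐ t ∂((volume : Measure ℝ).restrict (Set.Ici 0)),
      0 ≤ t ∧ ∀ k : ℕ, t ≠ 2 * (k : ℝ) :=
    (ae_restrict_mem measurableSet_Ici).and
      (ae_all_iff.2 fun k => ae_restrict_of_ae (Measure.ae_ne volume _))
  exact (Measure.tendsto_eval_ae_ae (μ := fun _ : Fin n =>
    (volume : Measure ℝ).restrict (Set.Ici 0)) (i := j)).eventually ae_nonneg_not_even

lemma ae_mem_iUnion_box (n : ℕ) : ∀ᵐ x ∂leb n, x ∈ ⋃ κ : Fin n → ℕ, box κ := by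
  filter_upwards [ae_leb_nonneg_not_even n] with x hx
  refine Set.mem_iUnion.2 ⟨fun j => ⌊x j / 2⌋₊, fun j _ => Set.mem_Ico.2 ?_⟩
  have half_nonneg : 0 ≤ x j / 2 := by linarith [(hx j).1]
  constructor <;> linarith [Nat.floor_le half_nonneg, Nat.lt_floor_add_one (x j / 2)]

lemma leb_restrict_box {n : ℕ} (κ : Fin n → ℕ) :
    (leb n).restrict (box κ) = (2 ^ n : ℝ≥0∞) • Measure.pi fun j => boxLaw (κ j) := by
  have restrict_Ico (k : ℕ) : ((volume : Measure ℝ).restrict (Set.Ici 0)).restrict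
      (Set.Ico (2 * (k : ℝ)) (2 * (k : ℝ) + 2)) = (2 : ℝ≥0∞) • boxLaw k := by
    have Ico_subset_Ici : Set.Ico (2 * (k : ℝ)) (2 * (k : ℝ) + 2) ⊆ Set.Ici 0 :=
      fun t ht => le_trans (by positivity) ht.1
    rw [two_smul_boxLaw, Measure.restrict_restrict measurableSet_Ico,
      Set.inter_eq_left.2 Ico_subset_Ici, restrict_Ico_eq_restrict_Icc]
  have sigmaFinite (k : ℕ) : SigmaFinite ((2 : ℝ≥0∞) • boxLaw k) := by
    rw [two_smul_boxLaw]; infer_instance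
  rw [leb, box, Measure.restrict_pi_pi]
  simp only [restrict_Ico]
  refine Measure.pi_eq fun s _ => ?_
  rw [Measure.smul_apply, Measure.pi_pi]
  simp [Finset.prod_mul_distrib]

lemma leb_eq_sum (n : ℕ) :
    leb n = Measure.sum fun κ : Fin n → ℕ =>
      (2 ^ n : ℝ≥0∞) • Measure.pi fun j => boxLaw (κ j) := by
  rw [← Measure.restrict_eq_self_of_ae_mem (ae_mem_iUnion_box n),
    Measure.restrict_iUnion (pairwise_disjoint_box n) measurableSet_box]
  simp only [leb_restrict_box]

lemma pi_boxLaw_le_leb {n : ℕ} (κ : Fin n → ℕ) :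
    (Measure.pi fun j => boxLaw (κ j)) ≤ leb n := by
  rw [leb_eq_sum]
  refine le_trans ?_ (Measure.le_sum _ κ)
  intro s
  rw [Measure.smul_apply, smul_eq_mul]
  exact le_mul_of_one_le_left zero_le (one_le_pow₀ (by norm_num))

section Mix

variable {n i : ℕ} {e : Fin n → Fin i ⊕ ℕ}

/-- The point of `ℝⁿ` whose coordinates are, according to the pattern `e`, coordinates of the path
`x` or one of the extra variables `z`. -/
def mix (e : Fin n → Fin i ⊕ ℕ) (z : Fin i → ℝ) (x : ℕ → ℝ) (j : Fin n) : ℝ :=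
  Sum.elim z x (e j)

/-- The indices of the box occupied by `mix e z x` when `z` lies in the box with index `ζ`. -/
def mixIdx (e : Fin n → Fin i ⊕ ℕ) (ζ : Fin i → ℕ) (j : Fin n) : ℕ :=
  Sum.elim ζ id (e j)

lemma measurable_mix (e : Fin n → Fin i ⊕ ℕ) :
    Measurable (fun p : (Fin i → ℝ) × (ℕ → ℝ) => mix e p.1 p.2) := by
  refine measurable_pi_iff.2 fun j => ?_
  unfold mix
  rcases e j with a | b <;> simp only [Sum.elim_inl, Sum.elim_inr] <;> fun_prop

lemma measurePreserving_mix (he : Function.Injective e) (ζ : Fin i → ℕ) :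
    MeasurePreserving (fun p : (Fin i → ℝ) × (ℕ → ℝ) => mix e p.1 p.2)
      ((Measure.pi fun a => boxLaw (ζ a)).prod pathLaw)
      (Measure.pi fun j => boxLaw (mixIdx e ζ j)) := by
  have elim_boxLaw :
      Sum.elim (fun a => boxLaw (ζ a)) boxLaw = fun c => boxLaw (Sum.elim ζ id c) := by
    funext c; cases c <;> rfl
  have elim_preserving := measurePreserving_sumElim (fun a => boxLaw (ζ a)) boxLaw
  rw [elim_boxLaw, Measure.infinitePi_eq_pi] at elim_preserving
  have comp_preserving : MeasurePreserving (fun (y : Fin i ⊕ ℕ → ℝ) (j : Fin n) => y (e j))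
      (Measure.infinitePi fun c => boxLaw (Sum.elim ζ id c))
      (Measure.pi fun j => boxLaw (mixIdx e ζ j)) :=
    ⟨by fun_prop, by
      rw [Measure.map_infinitePi_infinitePi_of_inj he, Measure.infinitePi_eq_pi]; rfl⟩
  exact comp_preserving.comp elim_preserving

lemma injective_mixIdx (hl : ∀ a, ∃ j, e j = Sum.inl a) :
    Function.Injective (mixIdx e : (Fin i → ℕ) → (Fin n → ℕ)) := by
  intro ζ ζ' h
  funext a
  obtain ⟨j, hj⟩ := hl a
  simpa [mixIdx, hj] using congrFun h j

lemma map_mix_le_leb (he : Function.Injective e) (hl : ∀ a, ∃ j, e j = Sum.inl a) :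
    ((leb i).prod pathLaw).map (fun p => mix e p.1 p.2) ≤ leb n := by
  have hin : i ≤ n := by
    choose c hc using hl
    have injective_c : Function.Injective c := fun a b hab =>
      Sum.inl_injective (by rw [← hc a, hab, hc b])
    simpa using Fintype.card_le_of_injective c injective_c
  have map_box_le (ζ : Fin i → ℕ) :
      (((2 ^ i : ℝ≥0∞) • Measure.pi fun j => boxLaw (ζ j)).prod pathLaw).map
        (fun p => mix e p.1 p.2) ≤ (2 ^ n : ℝ≥0∞) • Measure.pi fun j => boxLaw (mixIdx e ζ j) := by
    rw [Measure.prod_smul_left, Measure.map_smul, (measurePreserving_mix he ζ).map_eq]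
    intro s
    simp only [Measure.smul_apply, smul_eq_mul]
    gcongr
    norm_num
  rw [leb_eq_sum i, Measure.prod_sum_left, Measure.map_sum (measurable_mix e).aemeasurable,
    leb_eq_sum n]
  refine Measure.le_iff.2 fun s hs => ?_
  rw [Measure.sum_apply _ hs, Measure.sum_apply _ hs]
  calc ∑' ζ, _
      ≤ ∑' ζ, ((2 ^ n : ℝ≥0∞) • Measure.pi fun j => boxLaw (mixIdx e ζ j)) s :=
        ENNReal.tsum_le_tsum fun ζ => map_box_le ζ s
    _ ≤ _ := ENNReal.tsum_comp_le_tsum_of_injective (injective_mixIdx hl)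
        (fun κ => ((2 ^ n : ℝ≥0∞) • Measure.pi fun j => boxLaw (κ j)) s)

lemma memLp_comp_mix (he : Function.Injective e) (hl : ∀ a, ∃ j, e j = Sum.inl a)
    {h : (Fin n → ℝ) → ℝ} {p : ℝ≥0∞} (hh : MemLp h p (leb n)) :
    MemLp (fun q : (Fin i → ℝ) × (ℕ → ℝ) => h (mix e q.1 q.2)) p ((leb i).prod pathLaw) :=
  (hh.mono_measure (map_mix_le_leb he hl)).comp_of_map (measurable_mix e).aemeasurable

end Mix

/-! ### Sums over boxes -/

section Orthogonal

lemma orthogonalFamily_span_singleton {ι E : Type*} [NormedAddCommGroup E]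
    [InnerProductSpace ℝ E] {v : ι → E} (hv : Pairwise fun i j => inner ℝ (v i) (v j) = 0) :
    OrthogonalFamily ℝ (fun i => (ℝ ∙ v i : Submodule ℝ E)) fun i => (ℝ ∙ v i).subtypeₗᵢ :=
  OrthogonalFamily.of_pairwise fun i j hij => Submodule.isOrtho_span.2 <| by
    rintro _ rfl _ rfl
    exact hv hij

variable {α ι : Type*} [MeasurableSpace α] {ν : Measure α} {F : ι → α → ℝ}

lemma pairwise_inner_toLp_eq_zero (hF : ∀ i, MemLp (F i) 2 ν)
    (hF_orth : Pairwise fun i j => ∫ x, F i x * F j x ∂ν = 0) :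
    Pairwise fun i j => inner ℝ ((hF i).toLp) ((hF j).toLp) = 0 := by
  intro i j hij
  rw [L2.inner_def, ← hF_orth hij]
  refine integral_congr_ae ?_
  filter_upwards [(hF i).coeFn_toLp, (hF j).coeFn_toLp] with x hxi hxj
  rw [hxi, hxj]
  simp [mul_comm]

lemma coeFn_finsetSum_toLp (hF : ∀ i, MemLp (F i) 2 ν) (s : Finset ι) :
    ⇑(∑ i ∈ s, (hF i).toLp) =ᵐ[ν] ∑ i ∈ s, F i := by
  filter_upwards [Lp.coeFn_fun_finsetSum s fun i => (hF i).toLp,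
    (Filter.eventually_all_finset s).2 fun i _ => (hF i).coeFn_toLp] with x hsum hterm
  rw [hsum, Finset.sum_apply]
  exact Finset.sum_congr rfl hterm

lemma eLpNorm_finsetSum_sq (hF : ∀ i, MemLp (F i) 2 ν)
    (hF_orth : Pairwise fun i j => ∫ x, F i x * F j x ∂ν = 0) (s : Finset ι) :
    eLpNorm (∑ i ∈ s, F i) 2 ν ^ 2 = ∑ i ∈ s, eLpNorm (F i) 2 ν ^ 2 := by
  have pythagoras : ‖∑ i ∈ s, (hF i).toLp‖ ^ 2 = ∑ i ∈ s, ‖(hF i).toLp‖ ^ 2 :=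
    (orthogonalFamily_span_singleton (pairwise_inner_toLp_eq_zero hF hF_orth)).norm_sum
      (fun i => ⟨(hF i).toLp, Submodule.mem_span_singleton_self _⟩) s
  have pythagoras_enorm := congrArg ENNReal.ofReal pythagoras
  rw [ENNReal.ofReal_sum_of_nonneg fun _ _ => by positivity] at pythagoras_enorm
  simpa only [ENNReal.ofReal_pow (norm_nonneg _), ofReal_norm, Lp.enorm_def,
    eLpNorm_congr_ae (coeFn_finsetSum_toLp hF s), eLpNorm_congr_ae (hF _).coeFn_toLp]
    using pythagoras_enorm

lemma exists_tendsto_eLpNorm_finsetSum (hF : ∀ i, MemLp (F i) 2 ν)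
    (hF_orth : Pairwise fun i j => ∫ x, F i x * F j x ∂ν = 0)
    (hF_sum : ∑' i, eLpNorm (F i) 2 ν ^ 2 ≠ ∞) :
    ∃ Z, MemLp Z 2 ν ∧ Tendsto (fun s => eLpNorm (∑ i ∈ s, F i - Z) 2 ν) atTop (𝓝 0) := by
  have summable_toLp : Summable fun i => (hF i).toLp := by
    refine ((orthogonalFamily_span_singleton
      (pairwise_inner_toLp_eq_zero hF hF_orth)).summable_iff_norm_sq_summable
      fun i => ⟨(hF i).toLp, Submodule.mem_span_singleton_self _⟩).2 ?_
    refine (ENNReal.summable_toReal hF_sum).congr fun i => ?_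
    rw [ENNReal.toReal_pow, Submodule.coe_norm, Lp.norm_toLp]
  set Z : Lp ℝ 2 ν := ∑' i, (hF i).toLp
  exact ⟨Z, Lp.memLp Z,
    ((Lp.tendsto_Lp_iff_tendsto_eLpNorm' _ Z).1 summable_toLp.hasSum).congr fun s =>
      eLpNorm_congr_ae ((coeFn_finsetSum_toLp hF s).sub EventuallyEq.rfl)⟩

end Orthogonal

section BoxTerm

variable {n : ℕ} {h h' : (Fin n → ℝ) → ℝ}

/-- The value of `h` at the coordinates in `B`, listed in increasing order. -/
def sect (h : (Fin n → ℝ) → ℝ) (B : Finset ℕ) (x : ℕ → ℝ) : ℝ :=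
  if hB : B.card = n then h (fun j => x (B.orderEmbOfFin hB j)) else 0

lemma sect_of_card (h : (Fin n → ℝ) → ℝ) {B : Finset ℕ} (hB : B.card = n) :
    sect h B = fun x => h (fun j => x (B.orderEmbOfFin hB j)) := by
  funext x; simp [sect, hB]

lemma sect_of_card_ne (h : (Fin n → ℝ) → ℝ) {B : Finset ℕ} (hB : B.card ≠ n) :
    sect h B = 0 := by
  funext x; simp [sect, hB]

lemma sect_sub (h h' : (Fin n → ℝ) → ℝ) (B : Finset ℕ) :
    sect (h - h') B = sect h B - sect h' B := by
  funext x
  by_cases hB : B.card = n <;> simp [sect, hB]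

lemma dependsOn_sect (h : (Fin n → ℝ) → ℝ) (B : Finset ℕ) :
    DependsOn (sect h B) (B : Set ℕ) := by
  intro x x' hx
  unfold sect
  split_ifs with hB
  · exact congrArg h (funext fun j => hx _ (B.orderEmbOfFin_mem hB j))
  · rfl

lemma ae_comp_of_ae_leb {p : (Fin n → ℝ) → Prop} (hp : ∀ᵐ x ∂leb n, p x)
    {κ : Fin n → ℕ} (hκ : Function.Injective κ) : ∀ᵐ x ∂pathLaw, p (fun j => x (κ j)) :=
  (measurePreserving_comp hκ).quasiMeasurePreserving.ae
    ((Measure.absolutelyContinuous_of_le (pi_boxLaw_le_leb κ)).ae_le hp)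

lemma exists_perm_orderEmbOfFin {κ : Fin n → ℕ} (hκ : Function.Injective κ) :
    ∃ (hB : (Finset.univ.image κ).card = n) (σ : Equiv.Perm (Fin n)),
      ∀ j, (Finset.univ.image κ).orderEmbOfFin hB (σ j) = κ j := by
  have hB : (Finset.univ.image κ).card = n := by
    rw [Finset.card_image_of_injective _ hκ, Finset.card_fin]
  set rank : Fin n → Fin n := fun j => ((Finset.univ.image κ).orderIsoOfFin hB).symm
    ⟨κ j, Finset.mem_image_of_mem _ (Finset.mem_univ _)⟩ with rank_def
  have rank_injective : Function.Injective rank := fun a b hab =>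
    hκ (Subtype.ext_iff.1 (((Finset.univ.image κ).orderIsoOfFin hB).symm.injective hab))
  refine ⟨hB, Equiv.ofBijective rank (Finite.injective_iff_bijective.1 rank_injective),
    fun j => ?_⟩
  rw [Equiv.ofBijective_apply, ← Finset.coe_orderIsoOfFin_apply, rank_def,
    OrderIso.apply_symm_apply]

lemma comp_ae_eq_sect (hs : ∀ σ : Equiv.Perm (Fin n), ∀ᵐ x ∂leb n, h (fun j => x (σ j)) = h x)
    {κ : Fin n → ℕ} (hκ : Function.Injective κ) :
    (fun x => h (fun j => x (κ j))) =ᵐ[pathLaw] sect h (Finset.univ.image κ) := by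
  obtain ⟨hB, σ, hσ⟩ := exists_perm_orderEmbOfFin hκ
  filter_upwards [ae_comp_of_ae_leb (hs σ)
    ((Finset.univ.image κ).orderEmbOfFin hB).injective] with x hx
  simpa only [sect_of_card h hB, hσ] using hx

lemma memLp_sect {p : ℝ≥0∞} (hh : MemLp h p (leb n)) (B : Finset ℕ) :
    MemLp (sect h B) p pathLaw := by
  by_cases hB : B.card = n
  · rw [sect_of_card h hB]
    exact (hh.mono_measure (pi_boxLaw_le_leb _)).comp_measurePreserving
      (measurePreserving_comp (B.orderEmbOfFin hB).injective)
  · rw [sect_of_card_ne h hB]; exact MemLp.zero'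

lemma eLpNorm_sect_rpow_le {p : ℝ≥0∞} (hp : p ≠ 0) (hp' : p ≠ ∞)
    (hh : AEStronglyMeasurable h (leb n)) {B : Finset ℕ} (hB : B.card = n) :
    eLpNorm (sect h B) p pathLaw ^ p.toReal ≤
      ∫⁻ x, ‖h x‖ₑ ^ p.toReal ∂((2 ^ n : ℝ≥0∞) • Measure.pi fun j =>
        boxLaw (B.orderEmbOfFin hB j)) := by
  have hpos : 0 < p.toReal := ENNReal.toReal_pos hp hp'
  rw [sect_of_card h hB, ← Function.comp_def, eLpNorm_comp_measurePreserving
      (hh.mono_measure (pi_boxLaw_le_leb _))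
      (measurePreserving_comp (B.orderEmbOfFin hB).injective),
    eLpNorm_eq_lintegral_rpow_enorm_toReal hp hp', ← ENNReal.rpow_mul, one_div,
    inv_mul_cancel₀ hpos.ne', ENNReal.rpow_one, lintegral_smul_measure, smul_eq_mul]
  exact le_mul_of_one_le_left zero_le (one_le_pow₀ (by norm_num))

lemma tsum_eLpNorm_sect_rpow_le {p : ℝ≥0∞} (hp : p ≠ 0) (hp' : p ≠ ∞)
    (hh : AEStronglyMeasurable h (leb n)) :
    ∑' B : Finset ℕ, eLpNorm (sect h B) p pathLaw ^ p.toReal ≤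
      eLpNorm h p (leb n) ^ p.toReal := by
  have hpos : 0 < p.toReal := ENNReal.toReal_pos hp hp'
  have support_subset : (Function.support fun B : Finset ℕ =>
      eLpNorm (sect h B) p pathLaw ^ p.toReal) ⊆ {B | B.card = n} := by
    intro B hB
    by_contra hcard
    exact hB (by simp [sect_of_card_ne h hcard, hpos])
  have orderEmbOfFin_injective : Function.Injective fun (B : {B : Finset ℕ | B.card = n})
      (j : Fin n) => B.1.orderEmbOfFin B.2 j := by
    intro B B' hBB'
    refine Subtype.ext (Finset.coe_injective ?_)
    rw [← B.1.range_orderEmbOfFin B.2, ← B'.1.range_orderEmbOfFin B'.2]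
    exact congrArg Set.range hBB'
  calc ∑' B : Finset ℕ, eLpNorm (sect h B) p pathLaw ^ p.toReal
      = ∑' B : {B : Finset ℕ | B.card = n}, eLpNorm (sect h B.1) p pathLaw ^ p.toReal :=
        (tsum_subtype_eq_of_support_subset support_subset).symm
    _ ≤ ∑' B : {B : Finset ℕ | B.card = n}, ∫⁻ x, ‖h x‖ₑ ^ p.toReal ∂((2 ^ n : ℝ≥0∞) •
          Measure.pi fun j => boxLaw (B.1.orderEmbOfFin B.2 j)) :=
        ENNReal.tsum_le_tsum fun B => eLpNorm_sect_rpow_le hp hp' hh B.2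
    _ ≤ ∑' κ : Fin n → ℕ, ∫⁻ x, ‖h x‖ₑ ^ p.toReal ∂((2 ^ n : ℝ≥0∞) •
          Measure.pi fun j => boxLaw (κ j)) :=
        ENNReal.tsum_comp_le_tsum_of_injective orderEmbOfFin_injective _
    _ = eLpNorm h p (leb n) ^ p.toReal := by
        rw [eLpNorm_eq_lintegral_rpow_enorm_toReal hp hp', ← ENNReal.rpow_mul, one_div,
          inv_mul_cancel₀ hpos.ne', ENNReal.rpow_one, leb_eq_sum, lintegral_sum_measure]

lemma tsum_eLpNorm_sect_sq_le (hh : AEStronglyMeasurable h (leb n)) :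
    ∑' B : Finset ℕ, eLpNorm (sect h B) 2 pathLaw ^ 2 ≤ eLpNorm h 2 (leb n) ^ 2 := by
  simpa using tsum_eLpNorm_sect_rpow_le two_ne_zero (by norm_num) hh

/-- The contribution to the multiple integral of the boxes with indices in `B`. -/
def boxTerm (h : (Fin n → ℝ) → ℝ) (B : Finset ℕ) : (ℕ → ℝ) → ℝ :=
  centerPart boxLaw B (sect h B)

/-- The multiple integral over the boxes with indices less than `M`. -/
def partialIntegral (M : ℕ) (h : (Fin n → ℝ) → ℝ) : (ℕ → ℝ) → ℝ :=
  (n ! : ℝ) • ∑ B ∈ (Finset.range M).powerset, boxTerm h B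

lemma boxTerm_of_card_ne (h : (Fin n → ℝ) → ℝ) {B : Finset ℕ} (hB : B.card ≠ n) :
    boxTerm h B = 0 := by
  funext x
  simp [boxTerm, sect_of_card_ne h hB, centerPart, resample]

lemma memLp_boxTerm (hh : MemLp h 2 (leb n)) (B : Finset ℕ) : MemLp (boxTerm h B) 2 pathLaw :=
  memLp_centerPart one_le_two ENNReal.ofNat_ne_top (memLp_sect hh B) B

lemma memLp_partialIntegral (hh : MemLp h 2 (leb n)) (M : ℕ) :
    MemLp (partialIntegral M h) 2 pathLaw :=
  (memLp_finsetSum' _ fun B _ => memLp_boxTerm hh B).const_smul _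

lemma dependsOn_boxTerm (h : (Fin n → ℝ) → ℝ) (B : Finset ℕ) :
    DependsOn (boxTerm h B) (B : Set ℕ) := dependsOn_centerPart (dependsOn_sect h B) B

lemma isCentered_boxTerm (hh : MemLp h 2 (leb n)) {B : Finset ℕ} {k : ℕ} (hk : k ∈ B) :
    IsCentered boxLaw k (boxTerm h B) :=
  isCentered_centerPart ((memLp_sect hh B).integrable one_le_two) hk

lemma integral_boxTerm_mul_boxTerm (hh : MemLp h 2 (leb n)) :
    Pairwise fun B B' => ∫ x, boxTerm h B x * boxTerm h B' x ∂pathLaw = 0 := by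
  intro B B' hne
  by_cases hB : B.card = n
  swap
  · simp [boxTerm_of_card_ne h hB]
  by_cases hB' : B'.card = n
  swap
  · simp [boxTerm_of_card_ne h hB']
  obtain ⟨k, hk, hk'⟩ : ∃ k ∈ B, k ∉ B' := by
    by_contra! hsub
    exact hne (Finset.eq_of_subset_of_card_le hsub (by lia))
  exact integral_mul_eq_zero (isCentered_boxTerm hh hk)
    ((dependsOn_boxTerm h B').mono (Set.subset_compl_singleton_iff.2 hk'))
    ((memLp_boxTerm hh B).integrable_mul (memLp_boxTerm hh B'))

lemma eLpNorm_boxTerm_le (hh : MemLp h 2 (leb n)) (B : Finset ℕ) :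
    eLpNorm (boxTerm h B) 2 pathLaw ≤ 2 ^ n * eLpNorm (sect h B) 2 pathLaw := by
  by_cases hB : B.card = n
  · exact hB ▸ eLpNorm_centerPart_le one_le_two ENNReal.ofNat_ne_top (memLp_sect hh B) B
  · simp [boxTerm_of_card_ne h hB]

lemma tsum_eLpNorm_boxTerm_sq_le (hh : MemLp h 2 (leb n)) :
    ∑' B, eLpNorm (boxTerm h B) 2 pathLaw ^ 2 ≤ (2 ^ n * eLpNorm h 2 (leb n)) ^ 2 :=
  calc ∑' B, eLpNorm (boxTerm h B) 2 pathLaw ^ 2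
      ≤ ∑' B, (2 ^ n) ^ 2 * eLpNorm (sect h B) 2 pathLaw ^ 2 :=
        ENNReal.tsum_le_tsum fun B => by rw [← mul_pow]; gcongr; exact eLpNorm_boxTerm_le hh B
    _ ≤ (2 ^ n) ^ 2 * eLpNorm h 2 (leb n) ^ 2 := by
        rw [ENNReal.tsum_mul_left]
        gcongr
        exact tsum_eLpNorm_sect_sq_le hh.1
    _ = (2 ^ n * eLpNorm h 2 (leb n)) ^ 2 := (mul_pow _ _ _).symm

lemma eLpNorm_partialIntegral_le (hh : MemLp h 2 (leb n)) (M : ℕ) :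
    eLpNorm (partialIntegral M h) 2 pathLaw ≤ (n ! : ℝ≥0∞) * (2 ^ n * eLpNorm h 2 (leb n)) := by
  rw [partialIntegral, eLpNorm_const_smul, ← ofReal_norm, Real.norm_natCast,
    ENNReal.ofReal_natCast]
  gcongr
  rw [← ENNReal.pow_le_pow_left_iff two_ne_zero,
    eLpNorm_finsetSum_sq (memLp_boxTerm hh) (integral_boxTerm_mul_boxTerm hh)]
  exact (ENNReal.sum_le_tsum _).trans (tsum_eLpNorm_boxTerm_sq_le hh)

lemma tendsto_powerset_range :
    Tendsto (fun M => (Finset.range M).powerset) atTop atTop := by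
  refine tendsto_atTop_finset_of_monotone
    (fun M M' hM => Finset.powerset_mono.2 (Finset.range_mono hM)) fun B => ?_
  obtain ⟨N, hN⟩ := B.exists_nat_subset_range
  exact ⟨N, Finset.mem_powerset.2 hN⟩

lemma exists_tendsto_partialIntegral (hh : MemLp h 2 (leb n)) :
    ∃ Z, MemLp Z 2 pathLaw ∧
      Tendsto (fun M => eLpNorm (partialIntegral M h - Z) 2 pathLaw) atTop (𝓝 0) := by
  obtain ⟨Z, hZ, hlim⟩ := exists_tendsto_eLpNorm_finsetSum (memLp_boxTerm hh)
    (integral_boxTerm_mul_boxTerm hh)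
    (ne_top_of_le_ne_top (by finiteness [hh.2.ne]) (tsum_eLpNorm_boxTerm_sq_le hh))
  refine ⟨(n ! : ℝ) • Z, hZ.const_smul _, ?_⟩
  simp only [partialIntegral, ← smul_sub, eLpNorm_const_smul]
  simpa using ENNReal.Tendsto.const_mul (hlim.comp tendsto_powerset_range)
    (Or.inr (enorm_ne_top (x := (n ! : ℝ))))

lemma partialIntegral_sub (hh : MemLp h 2 (leb n)) (hh' : MemLp h' 2 (leb n)) (M : ℕ) :
    partialIntegral M (h - h') =ᵐ[pathLaw] partialIntegral M h - partialIntegral M h' := by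
  have boxTerm_sub (B : Finset ℕ) :
      boxTerm (h - h') B =ᵐ[pathLaw] boxTerm h B - boxTerm h' B := by
    unfold boxTerm
    rw [sect_sub]
    exact centerPart_sub ((memLp_sect hh B).integrable one_le_two)
      ((memLp_sect hh' B).integrable one_le_two) B
  filter_upwards [ae_all_iff.2 boxTerm_sub] with x hx
  simp only [partialIntegral, Pi.smul_apply, Finset.sum_apply, hx, Pi.sub_apply,
    Finset.sum_sub_distrib, smul_sub]

end BoxTerm

section Tuples

variable {a : ℕ}

lemma image_orderEmbOfFin_perm {A : Finset ℕ} (hA : A.card = a) (σ : Equiv.Perm (Fin a)) :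
    Finset.univ.image (fun j => A.orderEmbOfFin hA (σ j)) = A := by
  have range_eq := (σ.surjective.range_comp (A.orderEmbOfFin hA)).trans (A.range_orderEmbOfFin hA)
  exact Finset.coe_injective (by simpa [Function.comp_def] using range_eq)

/-- An injective tuple amounts to its image together with an ordering of the image. -/
def embeddingEquiv (a : ℕ) :
    {A : Finset ℕ // A.card = a} × Equiv.Perm (Fin a) ≃ (Fin a ↪ ℕ) :=
  Equiv.ofBijective
    (fun q => ⟨fun j => q.1.1.orderEmbOfFin q.1.2 (q.2 j),
      (q.1.1.orderEmbOfFin q.1.2).injective.comp q.2.injective⟩) <| by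
    constructor
    · rintro ⟨⟨A, hA⟩, σ⟩ ⟨⟨A', hA'⟩, σ'⟩ h
      have values_eq := fun j => DFunLike.congr_fun h j
      simp only [Function.Embedding.coeFn_mk] at values_eq
      obtain rfl : A = A' := by
        rw [← image_orderEmbOfFin_perm hA σ, ← image_orderEmbOfFin_perm hA' σ']
        simp only [values_eq]
      obtain rfl : σ = σ' := Equiv.ext fun j => (A.orderEmbOfFin hA).injective (values_eq j)
      rfl
    · intro κ
      obtain ⟨hB, σ, hσ⟩ := exists_perm_orderEmbOfFin κ.injective
      exact ⟨⟨⟨_, hB⟩, σ⟩, Function.Embedding.ext hσ⟩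

lemma card_image_eq_iff (κ : Fin a → ℕ) :
    (Finset.univ.image κ).card = a ↔ Function.Injective κ := by
  rw [← Set.injOn_univ, ← Finset.coe_univ, ← Finset.card_image_iff, Finset.card_fin]

lemma tsum_embedding {G : Finset ℕ → ℝ} (hG : Summable G) (hG_card : ∀ A, A.card ≠ a → G A = 0) :
    ∑' κ : Fin a ↪ ℕ, G (Finset.univ.image κ) = a ! * ∑' A, G A := by
  have summable_subtype : Summable fun A : {A : Finset ℕ // A.card = a} => G A :=
    hG.comp_injective Subtype.val_injective
  have summable_fst :
      Summable fun q : {A : Finset ℕ // A.card = a} × Equiv.Perm (Fin a) => G q.1 := by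
    have summable_one : Summable fun _ : Equiv.Perm (Fin a) => ‖(1 : ℝ)‖ := Summable.of_finite
    exact (summable_mul_of_summable_norm summable_subtype.norm summable_one).congr fun q => by simp
  calc ∑' κ : Fin a ↪ ℕ, G (Finset.univ.image κ)
      = ∑' q, G (Finset.univ.image (embeddingEquiv a q)) :=
        ((embeddingEquiv a).tsum_eq fun κ : Fin a ↪ ℕ => G (Finset.univ.image κ)).symm
    _ = ∑' q : {A : Finset ℕ // A.card = a} × Equiv.Perm (Fin a), G q.1 :=
        tsum_congr fun q => congrArg G (image_orderEmbOfFin_perm q.1.2 q.2)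
    _ = a ! * ∑' A : {A : Finset ℕ // A.card = a}, G A := by
        rw [summable_fst.tsum_prod]
        simp [tsum_mul_left, Fintype.card_perm]
    _ = a ! * ∑' A, G A := by
        exact congrArg _ (tsum_subtype_eq_of_support_subset (s := {A : Finset ℕ | A.card = a})
          fun A hA => not_imp_comm.1 (hG_card A) hA)

lemma tsum_tuple {G : Finset ℕ → ℝ} (hG : Summable G) (hG_card : ∀ A, A.card ≠ a → G A = 0) :
    ∑' κ : Fin a → ℕ, G (Finset.univ.image κ) = a ! * ∑' A, G A := by
  rw [← tsum_embedding hG hG_card]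
  refine (Function.Injective.tsum_eq (g := fun κ : Fin a ↪ ℕ => (κ : Fin a → ℕ))
    DFunLike.coe_injective fun κ hκ => ?_).symm
  have injective_κ := (card_image_eq_iff κ).1 (not_imp_comm.1 (hG_card _) hκ)
  exact ⟨⟨κ, injective_κ⟩, rfl⟩

end Tuples

section SplitSums

variable {n r : ℕ} {R : Finset ℕ → Finset ℕ → ℝ}

lemma symmDiff_term_eq (hr : r ≤ n) (hR : ∀ B C, B.card ≠ n → R B C = 0) (D C : Finset ℕ) :
    (if C ⊆ symmDiff D C ∧ C.card = n - r then R (symmDiff D C) C else 0) =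
      if D.card = r ∧ C.card = n - r then R (D ∪ C) C else 0 := by
  by_cases disjoint : Disjoint D C
  · have symmDiff_eq : symmDiff D C = D ∪ C := disjoint.symmDiff_eq_sup
    rw [symmDiff_eq]
    by_cases hD : D.card = r
    · simp [hD, Finset.subset_union_right]
    · simp only [Finset.subset_union_right, true_and, hD, false_and, if_false]
      refine ite_eq_right_iff.2 fun hC => hR _ _ ?_
      rw [Finset.card_union_of_disjoint disjoint]; omega
  · have not_subset : ¬ C ⊆ symmDiff D C := fun hsub =>
      disjoint <| Finset.disjoint_left.2 fun k hkD hkC => by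
        simpa [Finset.mem_symmDiff, hkD, hkC] using hsub hkC
    rw [if_neg fun h => not_subset h.1]
    refine (ite_eq_right_iff.2 fun cards => hR _ _ ?_).symm
    have inter_pos : 0 < (D ∩ C).card :=
      Finset.card_pos.2 (Finset.not_disjoint_iff_nonempty_inter.1 disjoint)
    have := Finset.card_union_add_card_inter D C
    omega

/-- The involution `(D, C) ↦ (D ∆ C, C)`, which exchanges pairs of disjoint sets with pairs in
which the first set contains the second. -/
def symmDiffEquiv : Finset ℕ × Finset ℕ ≃ Finset ℕ × Finset ℕ :=
  ⟨fun q => (symmDiff q.1 q.2, q.2), fun q => (symmDiff q.1 q.2, q.2),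
    fun q => by simp, fun q => by simp⟩

lemma tsum_union_image (hr : r ≤ n) (hR : ∀ B C, B.card ≠ n → R B C = 0)
    (hR_sum : Summable fun q : Finset ℕ × Finset ℕ =>
      if q.1.card = r ∧ q.2.card = n - r then R (q.1 ∪ q.2) q.2 else 0) :
    ∑' κ : Fin r ↪ ℕ, ∑' ζ : Fin (n - r) → ℕ,
      R (Finset.univ.image κ ∪ Finset.univ.image ζ) (Finset.univ.image ζ) =
      (r ! * (n - r)! : ℝ) * ∑' q : Finset ℕ × Finset ℕ,
        if q.1.card = r ∧ q.2.card = n - r then R (q.1 ∪ q.2) q.2 else 0 := by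
  set u : Finset ℕ × Finset ℕ → ℝ := fun q =>
    if q.1.card = r ∧ q.2.card = n - r then R (q.1 ∪ q.2) q.2 else 0 with hu
  have tsum_ζ (κ : Fin r ↪ ℕ) : ∑' ζ : Fin (n - r) → ℕ,
      R (Finset.univ.image κ ∪ Finset.univ.image ζ) (Finset.univ.image ζ) =
        (n - r)! * ∑' C, u (Finset.univ.image κ, C) := by
    have card_κ := (card_image_eq_iff κ).2 κ.injective
    rw [← tsum_tuple (hR_sum.prod_factor _) fun C hC => if_neg fun h => hC h.2]
    refine tsum_congr fun ζ => ?_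
    simp only [hu, card_κ, true_and, left_eq_ite_iff]
    refine fun hζ => hR _ _ fun hcard => hζ (le_antisymm ?_ ?_)
    · simpa using Finset.card_image_le (s := Finset.univ) (f := ζ)
    · have := Finset.card_union_le (Finset.univ.image κ) (Finset.univ.image ζ)
      omega
  have tsum_κ : ∑' κ : Fin r ↪ ℕ, ∑' C, u (Finset.univ.image κ, C) = r ! * ∑' q, u q := by
    rw [hR_sum.tsum_prod]
    exact tsum_embedding (G := fun D => ∑' C, u (D, C)) hR_sum.prod
      fun D hD => by simp [hu, hD]
  simp_rw [tsum_ζ]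
  rw [tsum_mul_left, tsum_κ]
  ring

lemma hasSum_union_image (hr : r ≤ n) (hR : ∀ B C, B.card ≠ n → R B C = 0)
    (hR_sum : Summable fun q : Finset ℕ × Finset ℕ => if q.2 ⊆ q.1 then R q.1 q.2 else 0) :
    HasSum (fun B => (r ! * (n - r)! : ℝ) * ∑ C ∈ B.powersetCard (n - r), R B C)
      (∑' κ : Fin r ↪ ℕ, ∑' ζ : Fin (n - r) → ℕ,
        R (Finset.univ.image κ ∪ Finset.univ.image ζ) (Finset.univ.image ζ)) := by
  set v : Finset ℕ × Finset ℕ → ℝ := fun q =>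
    if q.2 ⊆ q.1 ∧ q.2.card = n - r then R q.1 q.2 else 0 with hv
  have v_comp (q : Finset ℕ × Finset ℕ) : v (symmDiffEquiv q) =
      if q.1.card = r ∧ q.2.card = n - r then R (q.1 ∪ q.2) q.2 else 0 :=
    symmDiff_term_eq hr hR q.1 q.2
  have summable_v : Summable v := by
    refine (hR_sum.indicator {q | q.2.card = n - r}).congr fun q => ?_
    simp only [Set.indicator_apply, Set.mem_ofPred_eq, hv, ite_and]
    split_ifs <;> rfl
  rw [tsum_union_image hr hR ((symmDiffEquiv.summable_iff.2 summable_v).congr v_comp),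
    ← tsum_congr v_comp, symmDiffEquiv.tsum_eq v]
  refine (summable_v.hasSum.prod_fiberwise fun B => ?_).mul_left _
  have sum_eq : ∑ C ∈ B.powersetCard (n - r), R B C = ∑ C ∈ B.powersetCard (n - r), v (B, C) :=
    Finset.sum_congr rfl fun C hC => (if_pos (Finset.mem_powersetCard.1 hC)).symm
  rw [sum_eq]
  exact hasSum_sum_of_ne_finset_zero fun C hC => if_neg fun h => hC (Finset.mem_powersetCard.2 h)

end SplitSums

/-! ### The explicit multiple integral -/

lemma ae_eq_zero_of_not_injective {n : ℕ} {h : (Fin n → ℝ) → ℝ}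
    (hv : ∀ᵐ x ∂leb n, x ∉ offDiag n → h x = 0) {κ : Fin n → ℕ} (hκ : ¬ Function.Injective κ) :
    ∀ᵐ x ∂(Measure.pi fun j => boxLaw (κ j)), h x = 0 := by
  have ae_le := (Measure.absolutelyContinuous_of_le (pi_boxLaw_le_leb κ)).ae_le
  have ae_mem_Icc : ∀ᵐ x ∂(Measure.pi fun j => boxLaw (κ j)), ∀ j,
      x j ∈ Set.Icc (2 * (κ j : ℝ)) (2 * (κ j : ℝ) + 2) :=
    ae_all_iff.2 fun j => (Measure.tendsto_eval_ae_ae (μ := fun j => boxLaw (κ j))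
      (i := j)).eventually (Measure.ae_smul_measure (ae_restrict_mem measurableSet_Icc) _)
  filter_upwards [ae_le hv, ae_le (ae_leb_nonneg_not_even n), ae_mem_Icc]
    with x vanish not_even mem_Icc
  refine vanish fun ⟨κ', injective_κ', mem_Icc'⟩ => hκ ?_
  have mem_box {ν : Fin n → ℕ} (hν : ∀ j, x j ∈ Set.Icc (2 * (ν j : ℝ)) (2 * (ν j : ℝ) + 2)) :
      x ∈ box ν := fun j _ => ⟨(hν j).1, lt_of_le_of_ne (hν j).2 fun h =>
    (not_even j).2 (ν j + 1) (by rw [h]; push_cast; ring)⟩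
  have κ_eq : κ = κ' := by
    by_contra hne
    exact Set.disjoint_left.1 (pairwise_disjoint_box n hne) (mem_box mem_Icc) (mem_box mem_Icc')
  exact κ_eq ▸ injective_κ'

section MixSections

variable {n i : ℕ} {e : Fin n → Fin i ⊕ ℕ} {ζ : Fin i → ℕ}

/-- The indices of the coordinates of the path which occur in the pattern `e`. -/
def pathIdx (e : Fin n → Fin i ⊕ ℕ) : Finset ℕ := (Finset.univ.image e).toRight

@[simp]
lemma mem_pathIdx {b : ℕ} : b ∈ pathIdx e ↔ ∃ j, e j = Sum.inr b := by
  simp [pathIdx]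

lemma image_mixIdx (hl : ∀ a, ∃ j, e j = Sum.inl a) (ζ : Fin i → ℕ) :
    Finset.univ.image (mixIdx e ζ) = pathIdx e ∪ Finset.univ.image ζ := by
  ext k
  simp only [Finset.mem_image, Finset.mem_univ, true_and, Finset.mem_union, mixIdx, mem_pathIdx]
  constructor
  · rintro ⟨j, rfl⟩
    rcases hj : e j with a | b
    · exact Or.inr ⟨a, by simp⟩
    · exact Or.inl ⟨j, by simpa using hj⟩
  · rintro (⟨j, hj⟩ | ⟨a, rfl⟩)
    · exact ⟨j, by simp [hj]⟩
    · obtain ⟨j, hj⟩ := hl a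
      exact ⟨j, by simp [hj]⟩

lemma disjoint_image_pathIdx (hl : ∀ a, ∃ j, e j = Sum.inl a)
    (hζ : Function.Injective (mixIdx e ζ)) : Disjoint (Finset.univ.image ζ) (pathIdx e) := by
  simp only [Finset.disjoint_left, Finset.mem_image, Finset.mem_univ, true_and, mem_pathIdx]
  rintro _ ⟨a, rfl⟩ ⟨j, hj⟩
  obtain ⟨j', hj'⟩ := hl a
  have : j' = j := hζ (by simp [mixIdx, hj, hj'])
  simp [this, hj] at hj'

lemma mix_eq_piecewise (hl : ∀ a, ∃ j, e j = Sum.inl a) (hζ : Function.Injective (mixIdx e ζ))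
    (x y : ℕ → ℝ) :
    mix e (fun a => y (ζ a)) x =
      fun j => (Finset.univ.image ζ).piecewise y x (mixIdx e ζ j) := by
  funext j
  rcases hj : e j with a | b
  · simp [mix, mixIdx, hj, Finset.piecewise]
  · have b_notMem : b ∉ Finset.univ.image ζ :=
      Finset.disjoint_right.1 (disjoint_image_pathIdx hl hζ) (mem_pathIdx.2 ⟨j, hj⟩)
    rw [mix, mixIdx, hj, Sum.elim_inr, Sum.elim_inr, id,
      Finset.piecewise_eq_of_notMem _ _ _ b_notMem]

lemma injective_of_mixIdx (hl : ∀ a, ∃ j, e j = Sum.inl a)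
    (hζ : Function.Injective (mixIdx e ζ)) : Function.Injective ζ := by
  intro a a' haa
  obtain ⟨j, hj⟩ := hl a
  obtain ⟨j', hj'⟩ := hl a'
  have : j = j' := hζ (by simp [mixIdx, hj, hj', haa])
  rw [this, hj'] at hj
  exact (Sum.inl_injective hj).symm

variable {h : (Fin n → ℝ) → ℝ}

lemma integral_mix_box_of_injective (hh : MemHatL2 n h) (he : Function.Injective e)
    (hl : ∀ a, ∃ j, e j = Sum.inl a) (hζ : Function.Injective (mixIdx e ζ)) :
    ∀ᵐ x ∂pathLaw, ∫ z, h (mix e z x) ∂(Measure.pi fun a => boxLaw (ζ a)) =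
      resample boxLaw (Finset.univ.image ζ) (sect h (pathIdx e ∪ Finset.univ.image ζ)) x := by
  have comp_eq := comp_ae_eq_sect hh.symmetric hζ
  rw [image_mixIdx hl ζ] at comp_eq
  have aestronglyMeasurable_mix : ∀ᵐ x ∂pathLaw, AEStronglyMeasurable (fun z => h (mix e z x))
      (Measure.pi fun a => boxLaw (ζ a)) :=
    ((hh.memLp.1.mono_measure (pi_boxLaw_le_leb _)).comp_measurePreserving
      (measurePreserving_mix he ζ)).prod_swap.prodMk_left
  filter_upwards [aestronglyMeasurable_mix, resample_congr comp_eq (Finset.univ.image ζ)]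
    with x hx resample_eq
  have comp_preserving := measurePreserving_comp (injective_of_mixIdx hl hζ)
  rw [← resample_eq]
  rw [← comp_preserving.map_eq] at hx ⊢
  rw [integral_map comp_preserving.measurable.aemeasurable hx]
  simp only [mix_eq_piecewise hl hζ, resample]

lemma integral_mix_box (hh : MemHatL2 n h) (he : Function.Injective e)
    (hl : ∀ a, ∃ j, e j = Sum.inl a) (ζ : Fin i → ℕ) :
    ∀ᵐ x ∂pathLaw, ∫ z, h (mix e z x) ∂(Measure.pi fun a => boxLaw (ζ a)) =
      resample boxLaw (Finset.univ.image ζ) (sect h (pathIdx e ∪ Finset.univ.image ζ)) x := by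
  by_cases hζ : Function.Injective (mixIdx e ζ)
  · exact integral_mix_box_of_injective hh he hl hζ
  have vanish : ∀ᵐ x ∂pathLaw, ∀ᵐ z ∂(Measure.pi fun a => boxLaw (ζ a)), h (mix e z x) = 0 :=
    Measure.ae_ae_of_ae_prod (Measure.measurePreserving_swap.quasiMeasurePreserving.ae
      ((measurePreserving_mix he ζ).quasiMeasurePreserving.ae
        (ae_eq_zero_of_not_injective hh.vanish hζ)))
  have card_ne : (pathIdx e ∪ Finset.univ.image ζ).card ≠ n := by
    rwa [← image_mixIdx hl ζ, Ne, card_image_eq_iff]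
  filter_upwards [vanish] with x hx
  rw [integral_eq_zero_of_ae hx, sect_of_card_ne h card_ne]
  simp [resample]

lemma integral_mix_leb (hh : MemHatL2 n h) (hi : Integrable h (leb n))
    (he : Function.Injective e) (hl : ∀ a, ∃ j, e j = Sum.inl a) :
    ∀ᵐ x ∂pathLaw, ∫ z, h (mix e z x) ∂leb i =
      2 ^ i * ∑' ζ : Fin i → ℕ,
        resample boxLaw (Finset.univ.image ζ) (sect h (pathIdx e ∪ Finset.univ.image ζ)) x := by
  have integrable_mix : ∀ᵐ x ∂pathLaw, Integrable (fun z => h (mix e z x)) (leb i) :=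
    (memLp_one_iff_integrable.1
      (memLp_comp_mix he hl (memLp_one_iff_integrable.2 hi))).prod_left_ae
  filter_upwards [integrable_mix, ae_all_iff.2 fun ζ => integral_mix_box hh he hl ζ]
    with x hx integral_box
  rw [leb_eq_sum] at hx ⊢
  rw [integral_sum_measure hx, ← tsum_mul_left]
  refine tsum_congr fun ζ => ?_
  rw [integral_smul_measure, integral_box ζ]
  simp

end MixSections

section PathIntegral

variable {n : ℕ} {f h : (Fin n → ℝ) → ℝ}

/-- The pattern `(κ₁, …, κᵣ, y₁, …, yₙ₋ᵣ)` of the integrands of order `r` in the multiple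
integral. -/
def prefixPattern {r : ℕ} (κ : Fin r ↪ ℕ) (j : Fin n) : Fin (n - r) ⊕ ℕ :=
  if h : (j : ℕ) < r then Sum.inr (κ ⟨j, h⟩) else Sum.inl ⟨(j : ℕ) - r, by omega⟩

lemma injective_prefixPattern {r : ℕ} (κ : Fin r ↪ ℕ) :
    Function.Injective (prefixPattern κ : Fin n → Fin (n - r) ⊕ ℕ) := by
  intro j j' hjj'
  simp only [prefixPattern] at hjj'
  split_ifs at hjj'
  · simpa [Fin.ext_iff] using hjj'
  · simp only [Sum.inl.injEq, Fin.mk.injEq] at hjj'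
    ext; omega

lemma exists_prefixPattern_eq_inl {r : ℕ} (κ : Fin r ↪ ℕ) (a : Fin (n - r)) :
    ∃ j : Fin n, prefixPattern κ j = Sum.inl a :=
  ⟨⟨a + r, by omega⟩, by simp [prefixPattern]⟩

lemma pathIdx_prefixPattern {r : ℕ} (hr : r ≤ n) (κ : Fin r ↪ ℕ) :
    pathIdx (prefixPattern κ : Fin n → Fin (n - r) ⊕ ℕ) = Finset.univ.image κ := by
  ext b
  simp only [mem_pathIdx, Finset.mem_image, Finset.mem_univ, true_and]
  constructor
  · rintro ⟨j, hj⟩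
    unfold prefixPattern at hj
    split_ifs at hj
    exact ⟨_, Sum.inr_injective hj⟩
  · rintro ⟨j, rfl⟩
    exact ⟨⟨j, by omega⟩, by simp [prefixPattern]⟩

/-- The explicit multiple integral as a function of the sequence of jump times. -/
def pathIntegral (n : ℕ) (f : (Fin n → ℝ) → ℝ) (x : ℕ → ℝ) : ℝ :=
  ∑ r ∈ Finset.range (n + 1),
    (-1 : ℝ) ^ (n - r) / 2 ^ (n - r) * (n.choose r : ℝ) *
      ∑' κ : Fin r ↪ ℕ, ∫ y, f (mix (prefixPattern κ) y x) ∂leb (n - r)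

lemma elemIntegral_eq_pathIntegral_comp {Ω : Type*} (U : ℕ → Ω → ℝ) (f : (Fin n → ℝ) → ℝ) :
    elemIntegral U n f = pathIntegral n f ∘ fun ω k => jumpTime U k ω := by
  have mix_prefixPattern {r : ℕ} (κ : Fin r ↪ ℕ) (y : Fin (n - r) → ℝ) (x : ℕ → ℝ) :
      mix (prefixPattern κ) y x = fun j : Fin n =>
        if h : (j : ℕ) < r then x (κ ⟨j, h⟩) else y ⟨(j : ℕ) - r, by omega⟩ := by
    funext j
    unfold mix prefixPattern
    split_ifs <;> rfl
  funext ω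
  simp only [elemIntegral, pathIntegral, mix_prefixPattern, Function.comp_apply]

lemma tsum_eLpNorm_resample_le (hh : AEStronglyMeasurable h (leb n)) :
    ∑' q : Finset ℕ × Finset ℕ, (if q.2 ⊆ q.1 then
      eLpNorm (resample boxLaw q.2 (sect h q.1)) 1 pathLaw else 0) ≤
        2 ^ n * eLpNorm h 1 (leb n) := by
  have tsum_subsets_le (B : Finset ℕ) : ∑' C : Finset ℕ, (if C ⊆ B then
      eLpNorm (resample boxLaw C (sect h B)) 1 pathLaw else 0) ≤
        2 ^ n * eLpNorm (sect h B) 1 pathLaw := by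
    by_cases hB : B.card = n
    swap
    · have resample_eq (C : Finset ℕ) : resample boxLaw C (sect h B) = 0 := by
        funext x; simp [sect_of_card_ne h hB, resample]
      simp [resample_eq]
    have aestronglyMeasurable_sect : AEStronglyMeasurable (sect h B) pathLaw := by
      rw [← memLp_zero_iff_aestronglyMeasurable] at hh ⊢
      exact memLp_sect hh B
    rw [tsum_eq_sum (s := B.powerset) fun C hC => if_neg (mt Finset.mem_powerset.2 hC)]
    calc _ ≤ ∑ _ ∈ B.powerset, eLpNorm (sect h B) 1 pathLaw := by
          refine Finset.sum_le_sum fun C _ => ?_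
          split_ifs
          exacts [eLpNorm_resample_le aestronglyMeasurable_sect le_rfl ENNReal.one_ne_top C,
            zero_le]
      _ = 2 ^ n * eLpNorm (sect h B) 1 pathLaw := by simp [hB]
  calc _ ≤ ∑' B, 2 ^ n * eLpNorm (sect h B) 1 pathLaw := by
        rw [ENNReal.tsum_prod']
        exact ENNReal.tsum_le_tsum tsum_subsets_le
    _ ≤ 2 ^ n * eLpNorm h 1 (leb n) := by
        rw [ENNReal.tsum_mul_left]
        gcongr
        simpa using tsum_eLpNorm_sect_rpow_le one_ne_zero ENNReal.one_ne_top hh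

lemma ae_summable_resample (hh : Integrable h (leb n)) :
    ∀ᵐ x ∂pathLaw, Summable fun q : Finset ℕ × Finset ℕ =>
      if q.2 ⊆ q.1 then resample boxLaw q.2 (sect h q.1) x else 0 := by
  set F : Finset ℕ × Finset ℕ → (ℕ → ℝ) → ℝ := fun q x =>
    if q.2 ⊆ q.1 then resample boxLaw q.2 (sect h q.1) x else 0 with hF
  have aestronglyMeasurable_F (q) : AEStronglyMeasurable (F q) pathLaw := by
    have integrable_sect : Integrable (sect h q.1) pathLaw :=
      memLp_one_iff_integrable.1 (memLp_sect (memLp_one_iff_integrable.2 hh) q.1)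
    by_cases hq : q.2 ⊆ q.1
    · simpa only [hF, hq, if_true] using (integrable_resample integrable_sect q.2).1
    · simpa only [hF, hq, if_false] using aestronglyMeasurable_const
  have lintegral_F (q) : ∫⁻ x, ‖F q x‖ₑ ∂pathLaw = if q.2 ⊆ q.1 then
      eLpNorm (resample boxLaw q.2 (sect h q.1)) 1 pathLaw else 0 := by
    by_cases hq : q.2 ⊆ q.1 <;> simp [hF, hq, eLpNorm_one_eq_lintegral_enorm]
  have lintegral_ne_top : ∫⁻ x, ∑' q, ‖F q x‖ₑ ∂pathLaw ≠ ∞ := by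
    rw [lintegral_tsum fun q => (aestronglyMeasurable_F q).enorm, tsum_congr lintegral_F]
    exact ne_top_of_le_ne_top (ENNReal.mul_ne_top (by finiteness)
      (memLp_one_iff_integrable.2 hh).2.ne) (tsum_eLpNorm_resample_le hh.1)
  filter_upwards [ae_lt_top' (AEMeasurable.tsum fun q => (aestronglyMeasurable_F q).enorm)
    lintegral_ne_top] with x hx
  exact Summable.of_nnnorm (ENNReal.tsum_coe_ne_top_iff_summable.1 hx.ne)

lemma hasSum_tsum_integral_mix {r : ℕ} (hr : r ≤ n) (hh : MemHatL2 n h)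
    (hi : Integrable h (leb n)) :
    ∀ᵐ x ∂pathLaw, HasSum (fun B : Finset ℕ => (2 ^ (n - r) * (r ! * (n - r)!) : ℝ) *
        ∑ C ∈ B.powersetCard (n - r), resample boxLaw C (sect h B) x)
      (∑' κ : Fin r ↪ ℕ, ∫ y, h (mix (prefixPattern κ) y x) ∂leb (n - r)) := by
  have : Countable (Fin r ↪ ℕ) := DFunLike.coe_injective.countable
  filter_upwards [ae_summable_resample hi, ae_all_iff.2 fun κ : Fin r ↪ ℕ =>
    integral_mix_leb hh hi (injective_prefixPattern κ) (exists_prefixPattern_eq_inl κ)]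
    with x summable integral_mix
  have resample_eq_zero (B C : Finset ℕ) (hB : B.card ≠ n) :
      resample boxLaw C (sect h B) x = 0 := by
    simp [sect_of_card_ne h hB, resample]
  simp only [integral_mix, pathIdx_prefixPattern hr, tsum_mul_left, mul_assoc ((2 : ℝ) ^ _)]
  exact (hasSum_union_image hr resample_eq_zero summable).mul_left _

lemma hasSum_pathIntegral (hh : MemHatL2 n h) (hi : Integrable h (leb n)) :
    ∀ᵐ x ∂pathLaw, HasSum (fun B : Finset ℕ => (n ! : ℝ) * boxTerm h B x)
      (pathIntegral n h x) := by
  have hasSum_order : ∀ᵐ x ∂pathLaw, ∀ r ∈ Finset.range (n + 1), HasSum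
      (fun B : Finset ℕ => (2 ^ (n - r) * (r ! * (n - r)!) : ℝ) *
        ∑ C ∈ B.powersetCard (n - r), resample boxLaw C (sect h B) x)
      (∑' κ : Fin r ↪ ℕ, ∫ y, h (mix (prefixPattern κ) y x) ∂leb (n - r)) :=
    (Filter.eventually_all_finset _).2 fun r hr =>
      hasSum_tsum_integral_mix (Finset.mem_range_succ_iff.1 hr) hh hi
  filter_upwards [hasSum_order] with x hx
  refine (hasSum_sum fun r hr => (hx r hr).mul_left
    ((-1 : ℝ) ^ (n - r) / 2 ^ (n - r) * (n.choose r : ℝ))).congr_fun fun B => ?_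
  by_cases hB : B.card = n
  swap
  · simp [boxTerm_of_card_ne h hB, sect_of_card_ne h hB, resample]
  rw [boxTerm, centerPart, Finset.sum_powerset, hB, ← Finset.sum_range_reflect, Finset.mul_sum]
  refine Finset.sum_congr rfl fun r hr => ?_
  have choose_mul : (n.choose r : ℝ) * r ! * (n - r)! = n ! := by
    exact_mod_cast Nat.choose_mul_factorial_mul_factorial (Finset.mem_range_succ_iff.1 hr)
  rw [Nat.add_sub_cancel, Finset.mul_sum, Finset.mul_sum, Finset.mul_sum]
  refine Finset.sum_congr rfl fun C hC => ?_
  rw [(Finset.mem_powersetCard.1 hC).2, ← choose_mul]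
  field_simp

lemma tendsto_partialIntegral_ae (hh : MemHatL2 n h) (hi : Integrable h (leb n)) :
    ∀ᵐ x ∂pathLaw, Tendsto (fun M => partialIntegral M h x) atTop (𝓝 (pathIntegral n h x)) := by
  filter_upwards [hasSum_pathIntegral hh hi] with x hx
  refine (hx.comp tendsto_powerset_range).congr fun M => ?_
  simp [partialIntegral, Finset.mul_sum]

lemma aestronglyMeasurable_pathIntegral (hh : MemHatL2 n h) (hi : Integrable h (leb n)) :
    AEStronglyMeasurable (pathIntegral n h) pathLaw :=
  aestronglyMeasurable_of_tendsto_ae atTop (fun M => (memLp_partialIntegral hh.memLp M).1)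
    (tendsto_partialIntegral_ae hh hi)

/-- The random variable `Z` is the multiple integral of `f`, as a function of the sequence of jump
times: the limit in `L²` of the integrals of `f` over bounded regions. -/
structure IsPathLimit (f : (Fin n → ℝ) → ℝ) (Z : (ℕ → ℝ) → ℝ) : Prop where
  memLp : MemLp Z 2 pathLaw
  tendsto : Tendsto (fun M => eLpNorm (partialIntegral M f - Z) 2 pathLaw) atTop (𝓝 0)

lemma eLpNorm_pathIntegral_sub_le {Z : (ℕ → ℝ) → ℝ} (hf : MemLp f 2 (leb n))
    (hZ : IsPathLimit f Z) (hh : MemHatL2 n h) (hi : Integrable h (leb n)) :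
    eLpNorm (pathIntegral n h - Z) 2 pathLaw ≤
      (n ! : ℝ≥0∞) * 2 ^ n * eLpNorm (h - f) 2 (leb n) := by
  obtain ⟨ns, strictMono_ns, tendsto_f⟩ := (tendstoInMeasure_of_tendsto_eLpNorm (by norm_num)
    (fun M => (memLp_partialIntegral hf M).1) hZ.memLp.1 hZ.tendsto).exists_seq_tendsto_ae
  have tendsto_sub : ∀ᵐ x ∂pathLaw, Tendsto
      (fun k => (partialIntegral (ns k) h - partialIntegral (ns k) f) x) atTop
      (𝓝 ((pathIntegral n h - Z) x)) := by
    filter_upwards [tendsto_f, tendsto_partialIntegral_ae hh hi] with x lim_f lim_h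
    exact (lim_h.comp strictMono_ns.tendsto_atTop).sub lim_f
  refine (Lp.eLpNorm_lim_le_liminf_eLpNorm (fun k => ((memLp_partialIntegral hh.memLp _).sub
    (memLp_partialIntegral hf _)).1) _ tendsto_sub).trans ?_
  refine liminf_le_of_le (by isBoundedDefault) fun b hb => ?_
  obtain ⟨k, hk⟩ := hb.exists
  refine hk.trans ?_
  rw [eLpNorm_congr_ae (partialIntegral_sub hh.memLp hf (ns k)).symm, mul_assoc]
  exact eLpNorm_partialIntegral_le (hh.memLp.sub hf) _

end PathIntegral

section Truncation

variable {α : Type*} [MeasurableSpace α] {ν : Measure α} {F : α → ℝ}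

/-- The value `t`, replaced by `0` if it is smaller than `c` in absolute value. -/
def truncation (c t : ℝ) : ℝ := if c ≤ |t| then t else 0

lemma measurable_truncation (c : ℝ) : Measurable (truncation c) :=
  Measurable.ite (measurableSet_le measurable_const measurable_id.abs) measurable_id
    measurable_const

lemma norm_truncation_le (c t : ℝ) : ‖truncation c t‖ ≤ ‖t‖ := by
  unfold truncation; split_ifs <;> simp

lemma norm_truncation_sub_le (c t : ℝ) : ‖truncation c t - t‖ ≤ ‖t‖ := by
  unfold truncation; split_ifs <;> simp

lemma norm_truncation_le_inv_mul_sq {c : ℝ} (hc : 0 < c) (t : ℝ) :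
    ‖truncation c t‖ ≤ c⁻¹ * t ^ 2 := by
  unfold truncation
  split_ifs with ht
  · rw [Real.norm_eq_abs, ← sq_abs, inv_mul_eq_div, le_div_iff₀ hc]
    nlinarith [abs_nonneg t]
  · rw [norm_zero]; positivity

lemma aestronglyMeasurable_truncation (hF : AEStronglyMeasurable F ν) (c : ℝ) :
    AEStronglyMeasurable (fun x => truncation c (F x)) ν :=
  ((measurable_truncation c).comp_aemeasurable hF.aemeasurable).aestronglyMeasurable

lemma integrable_truncation (hF : MemLp F 2 ν) {c : ℝ} (hc : 0 < c) :
    Integrable (fun x => truncation c (F x)) ν :=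
  (hF.integrable_sq.const_mul c⁻¹).mono' (aestronglyMeasurable_truncation hF.1 c)
    (Eventually.of_forall fun x => norm_truncation_le_inv_mul_sq hc (F x))

lemma tendsto_eLpNorm_truncation_sub {p : ℝ≥0∞} (hp : p ≠ 0) (hp' : p ≠ ∞) (hF : MemLp F p ν) :
    Tendsto (fun c => eLpNorm ((fun x => truncation c (F x)) - F) p ν) (𝓝[>] 0) (𝓝 0) := by
  have p_pos := ENNReal.toReal_pos hp hp'
  have tendsto_lintegral :
      Tendsto (fun c => ∫⁻ x, ‖truncation c (F x) - F x‖ₑ ^ p.toReal ∂ν) (𝓝[>] 0) (𝓝 0) := by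
    rw [← lintegral_zero (μ := ν)]
    refine tendsto_lintegral_filter_of_dominated_convergence' (fun x => ‖F x‖ₑ ^ p.toReal)
      (Eventually.of_forall fun c =>
        (((aestronglyMeasurable_truncation hF.1 c).sub hF.1).enorm).pow_const _)
      (Eventually.of_forall fun c => Eventually.of_forall fun x => ?_)
      (lintegral_rpow_enorm_lt_top_of_eLpNorm_lt_top hp hp' hF.2).ne
      (Eventually.of_forall fun x => tendsto_const_nhds.congr' ?_)
    · gcongr
      exact enorm_le_iff_norm_le.2 (norm_truncation_sub_le c (F x))
    · by_cases hx : F x = 0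
      · simp [truncation, hx, p_pos]
      · filter_upwards [mem_nhdsWithin_of_mem_nhds (Iic_mem_nhds (abs_pos.2 hx))] with c hc
        simp [truncation, Set.mem_Iic.1 hc, p_pos]
  simp only [eLpNorm_eq_lintegral_rpow_enorm_toReal hp hp', Pi.sub_apply]
  simpa [Function.comp_def, p_pos] using
    (ENNReal.continuous_rpow_const (y := 1 / p.toReal)).continuousAt.tendsto.comp tendsto_lintegral

end Truncation

lemma memHatL2_truncation {n : ℕ} {f : (Fin n → ℝ) → ℝ} (hf : MemHatL2 n f) (c : ℝ) :
    MemHatL2 n fun x => truncation c (f x) where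
  memLp := hf.memLp.of_le (aestronglyMeasurable_truncation hf.memLp.1 c)
    (Eventually.of_forall fun x => norm_truncation_le c (f x))
  symmetric σ := by filter_upwards [hf.symmetric σ] with x hx using by rw [hx]
  vanish := by filter_upwards [hf.vanish] with x hx hx' using by simp [hx hx', truncation]

lemma exists_integrable_approx {n : ℕ} {f : (Fin n → ℝ) → ℝ} (hf : MemHatL2 n f) {δ : ℝ≥0∞}
    (hδ : 0 < δ) :
    ∃ h, MemHatL2 n h ∧ Integrable h (leb n) ∧ eLpNorm (h - f) 2 (leb n) ≤ δ := by
  obtain ⟨c, hcδ, hc⟩ :=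
    (((tendsto_eLpNorm_truncation_sub two_ne_zero ENNReal.ofNat_ne_top hf.memLp).eventually
      (ge_mem_nhds hδ)).and self_mem_nhdsWithin).exists
  exact ⟨_, memHatL2_truncation hf c, integrable_truncation hf.memLp hc, hcδ⟩

section Probability

variable {Ω : Type*} [MeasurableSpace Ω] {P : Measure Ω} [IsProbabilityMeasure P]
  {U : ℕ → Ω → ℝ} {n : ℕ} {f h : (Fin n → ℝ) → ℝ} {Z : (ℕ → ℝ) → ℝ}

lemma isMultipleIntegral_of_isPathLimit (hU : IsIIDUniform P U) (hf : MemHatL2 n f)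
    (hZ : IsPathLimit f Z) : IsMultipleIntegral P U n f (fun ω => Z (fun k => jumpTime U k ω)) where
  memLp := hZ.memLp.comp_measurePreserving (measurePreserving_jumpTime hU)
  approx _ hδ := exists_integrable_approx hf hδ
  tendsto ε hε := by
    refine ⟨ε / ((n ! : ℝ≥0∞) * 2 ^ n), ENNReal.div_pos hε.ne' (by finiteness),
      fun h hh hi hle => ?_⟩
    calc eLpNorm (elemIntegral U n h - fun ω => Z fun k => jumpTime U k ω) 2 P
        = eLpNorm (pathIntegral n h - Z) 2 pathLaw := by
          rw [elemIntegral_eq_pathIntegral_comp]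
          exact eLpNorm_comp_measurePreserving ((aestronglyMeasurable_pathIntegral hh hi).sub
            hZ.memLp.1) (measurePreserving_jumpTime hU)
      _ ≤ (n ! : ℝ≥0∞) * 2 ^ n * eLpNorm (h - f) 2 (leb n) :=
          eLpNorm_pathIntegral_sub_le hf.memLp hZ hh hi
      _ ≤ (n ! : ℝ≥0∞) * 2 ^ n * (ε / ((n ! : ℝ≥0∞) * 2 ^ n)) := by gcongr
      _ ≤ ε := ENNReal.mul_div_le

lemma IsMultipleIntegral.ae_eq (hU : IsIIDUniform P U) {Z Z' : Ω → ℝ}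
    (hZ : IsMultipleIntegral P U n f Z) (hZ' : IsMultipleIntegral P U n f Z') : Z =ᵐ[P] Z' := by
  have eLpNorm_sub_le_of_pos (ε : ℝ≥0∞) (hε : 0 < ε) : eLpNorm (Z - Z') 2 P ≤ ε := by
    obtain ⟨δ, hδ, close⟩ := hZ.tendsto (ε / 2) (ENNReal.half_pos hε.ne')
    obtain ⟨δ', hδ', close'⟩ := hZ'.tendsto (ε / 2) (ENNReal.half_pos hε.ne')
    obtain ⟨h, hh, hi, hle⟩ := hZ.approx (min δ δ') (lt_min hδ hδ')
    have aestronglyMeasurable_elem : AEStronglyMeasurable (elemIntegral U n h) P := by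
      rw [elemIntegral_eq_pathIntegral_comp]
      exact (aestronglyMeasurable_pathIntegral hh hi).comp_measurePreserving
        (measurePreserving_jumpTime hU)
    calc eLpNorm (Z - Z') 2 P
        = eLpNorm ((elemIntegral U n h - Z') - (elemIntegral U n h - Z)) 2 P := by
          rw [sub_sub_sub_cancel_left]
      _ ≤ eLpNorm (elemIntegral U n h - Z') 2 P + eLpNorm (elemIntegral U n h - Z) 2 P :=
          eLpNorm_sub_le (aestronglyMeasurable_elem.sub hZ'.memLp.1)
            (aestronglyMeasurable_elem.sub hZ.memLp.1) (by norm_num)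
      _ ≤ ε / 2 + ε / 2 := add_le_add (close' h hh hi (hle.trans (min_le_right _ _)))
          (close h hh hi (hle.trans (min_le_left _ _)))
      _ = ε := ENNReal.add_halves ε
  have eLpNorm_sub_eq_zero : eLpNorm (Z - Z') 2 P = 0 :=
    nonpos_iff_eq_zero.1 (le_of_forall_gt_imp_ge_of_dense eLpNorm_sub_le_of_pos)
  exact (sub_ae_eq_zero _ _).1
    ((eLpNorm_eq_zero_iff (hZ.memLp.sub hZ'.memLp).1 two_ne_zero).1 eLpNorm_sub_eq_zero)

lemma exists_isPathLimit (hf : MemLp f 2 (leb n)) : ∃ Z, IsPathLimit f Z :=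
  (exists_tendsto_partialIntegral hf).imp fun _ hZ => ⟨hZ.1, hZ.2⟩

lemma isMultipleIntegral_multipleIntegral (hU : IsIIDUniform P U) (hf : MemHatL2 n f) :
    IsMultipleIntegral P U n f (multipleIntegral P U n f) := by
  obtain ⟨Z, hZ⟩ := exists_isPathLimit hf.memLp
  have exists_value : ∃ Z, IsMultipleIntegral P U n f Z :=
    ⟨_, isMultipleIntegral_of_isPathLimit hU hf hZ⟩
  rw [multipleIntegral, dif_pos exists_value]
  exact exists_value.choose_spec

lemma multipleIntegral_ae_eq (hU : IsIIDUniform P U) (hf : MemHatL2 n f)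
    (hZ : IsPathLimit f Z) :
    multipleIntegral P U n f =ᵐ[P] fun ω => Z (fun k => jumpTime U k ω) :=
  (isMultipleIntegral_multipleIntegral hU hf).ae_eq hU (isMultipleIntegral_of_isPathLimit hU hf hZ)

end Probability

/-! ### Testing products of multiple integrals -/

lemma tendsto_integral_mul_mul {α κ : Type*} [MeasurableSpace α] {ν : Measure α} {l : Filter κ}
    {a b : κ → α → ℝ} {a' b' w : α → ℝ}
    (ha : ∀ M, MemLp (a M) 2 ν) (hb : ∀ M, MemLp (b M) 2 ν) (ha' : MemLp a' 2 ν)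
    (hb' : MemLp b' 2 ν) (hw : AEStronglyMeasurable w ν) (norm_w_le : ∀ x, ‖w x‖ ≤ 1)
    (lim_a : Tendsto (fun M => eLpNorm (a M - a') 2 ν) l (𝓝 0))
    (lim_b : Tendsto (fun M => eLpNorm (b M - b') 2 ν) l (𝓝 0)) :
    Tendsto (fun M => ∫ x, a M x * b M x * w x ∂ν) l (𝓝 (∫ x, a' x * b' x * w x ∂ν)) := by
  have norm_mul_w_le (u : α → ℝ) (x : α) : ‖u x * w x‖ ≤ ‖u x‖ := by
    rw [norm_mul]
    exact mul_le_of_le_one_right (norm_nonneg _) (norm_w_le x)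
  have memLp_mul_w {u : α → ℝ} (hu : MemLp u 2 ν) : MemLp (u * w) 2 ν :=
    hu.of_le (hu.1.mul hw) (Eventually.of_forall (norm_mul_w_le u))
  have lim_b_mul_w : Tendsto (fun M => eLpNorm (b M * w - b' * w) 2 ν) l (𝓝 0) :=
    tendsto_of_tendsto_of_tendsto_of_le_of_le tendsto_const_nhds lim_b (fun _ => zero_le)
      fun M => eLpNorm_mono fun x => by
        simpa only [Pi.sub_apply, Pi.mul_apply, sub_mul] using norm_mul_w_le (b M - b') x
  have inner_eq {u v : α → ℝ} (hu : MemLp u 2 ν) (hv : MemLp v 2 ν) :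
      inner ℝ hu.toLp (memLp_mul_w hv).toLp = ∫ x, u x * v x * w x ∂ν := by
    rw [L2.inner_def]
    refine integral_congr_ae ?_
    filter_upwards [hu.coeFn_toLp, (memLp_mul_w hv).coeFn_toLp] with x hux hvx
    rw [hux, hvx, Pi.mul_apply, RCLike.inner_apply, conj_trivial]
    ring
  have lim_inner := ((Lp.tendsto_Lp_iff_tendsto_eLpNorm'' a ha a' ha').2 lim_a).inner (𝕜 := ℝ)
    ((Lp.tendsto_Lp_iff_tendsto_eLpNorm'' _ (fun M => memLp_mul_w (hb M)) _
      (memLp_mul_w hb')).2 lim_b_mul_w)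
  rw [inner_eq ha' hb'] at lim_inner
  exact lim_inner.congr fun M => inner_eq (ha M) (hb M)

section Centering

variable {n : ℕ} {f : (Fin n → ℝ) → ℝ} {ψ : ℕ → ℝ → ℝ} {B S : Finset ℕ}

lemma integrable_sect (hf : MemLp f 2 (leb n)) (B : Finset ℕ) : Integrable (sect f B) pathLaw :=
  (memLp_sect hf B).integrable one_le_two

lemma integral_boxTerm_mul_testFn_of_ne (hf : MemLp f 2 (leb n)) (hψ : IsTest boxLaw ψ)
    (hBS : B ≠ S) : ∫ x, boxTerm f B x * testFn ψ S x ∂pathLaw = 0 := by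
  have integrable_mul :=
    hψ.integrable_mul S ((memLp_boxTerm hf B).integrable one_le_two)
  by_cases hsub : B ⊆ S
  · obtain ⟨k, hkS, hkB⟩ := Finset.exists_of_ssubset (hsub.ssubset_of_ne hBS)
    simp only [mul_comm (boxTerm f B _)] at integrable_mul ⊢
    exact integral_mul_eq_zero (hψ.isCentered hkS)
      ((dependsOn_boxTerm f B).mono (Set.subset_compl_singleton_iff.2 hkB)) integrable_mul
  · obtain ⟨k, hkB, hkS⟩ := Finset.not_subset.1 hsub
    exact integral_mul_eq_zero (isCentered_boxTerm hf hkB)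
      ((dependsOn_testFn ψ S).mono (Set.subset_compl_singleton_iff.2 hkS)) integrable_mul

lemma IsPathLimit.integral_mul_testFn (hf : MemLp f 2 (leb n)) {Z : (ℕ → ℝ) → ℝ}
    (hZ : IsPathLimit f Z) (hψ : IsTest boxLaw ψ) (S : Finset ℕ) :
    ∫ x, Z x * testFn ψ S x ∂pathLaw = n ! * ∫ x, sect f S x * testFn ψ S x ∂pathLaw := by
  have lim := tendsto_integral_mul_mul (b := fun _ _ => 1) (b' := fun _ => 1)
    (memLp_partialIntegral hf) (fun _ => memLp_const 1) hZ.memLp (memLp_const 1)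
    (hψ.measurable_testFn S).aestronglyMeasurable (hψ.norm_testFn_le S) hZ.tendsto (by simp)
  simp only [mul_one] at lim
  refine tendsto_nhds_unique lim (tendsto_const_nhds.congr' ?_)
  obtain ⟨N, hN⟩ := S.exists_nat_subset_range
  filter_upwards [eventually_ge_atTop N] with M hM
  have S_mem : S ∈ (Finset.range M).powerset :=
    Finset.mem_powerset.2 (hN.trans (Finset.range_mono hM))
  simp only [partialIntegral, Pi.smul_apply, Finset.sum_apply, smul_eq_mul, mul_assoc,
    Finset.sum_mul]
  rw [integral_const_mul, integral_finsetSum _ fun B _ =>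
      hψ.integrable_mul S ((memLp_boxTerm hf B).integrable one_le_two),
    Finset.sum_eq_single_of_mem S S_mem fun B _ hBS => integral_boxTerm_mul_testFn_of_ne hf hψ hBS]
  exact congrArg _ (integral_centerPart_mul_testFn (integrable_sect hf S) hψ S).symm

lemma integral_mix_cons_boxLaw (f : (Fin (n + 1) → ℝ) → ℝ) (κ : Fin n → ℕ) (k : ℕ) (x : ℕ → ℝ) :
    ∫ z, f (mix (Fin.cons (Sum.inl (0 : Fin 1)) fun j => Sum.inr (κ j)) z x)
        ∂(Measure.pi fun _ => boxLaw k) =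
      (2 : ℝ)⁻¹ * ∫ t in (2 * (k : ℝ))..(2 * (k : ℝ) + 2),
        f (Fin.cons t (fun j => x (κ j)) : Fin (n + 1) → ℝ) := by
  have mix_cons (z : Fin 1 → ℝ) :
      mix (Fin.cons (Sum.inl (0 : Fin 1)) fun j => Sum.inr (κ j)) z x =
        (Fin.cons (MeasurableEquiv.funUnique (Fin 1) ℝ z) (fun j => x (κ j)) : Fin (n + 1) → ℝ) :=
    funext <| Fin.cases (by simp [mix]) fun j => by simp [mix]
  simp only [mix_cons]
  calc _ = ∫ t, f (Fin.cons t (fun j => x (κ j)) : Fin (n + 1) → ℝ) ∂boxLaw k :=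
        (measurePreserving_funUnique (boxLaw k) (Fin 1)).integral_comp'
          fun t => f (Fin.cons t (fun j => x (κ j)) : Fin (n + 1) → ℝ)
    _ = _ := by
        rw [boxLaw, integral_smul_measure, integral_Icc_eq_integral_Ioc,
          ← intervalIntegral.integral_of_le (by linarith)]
        simp

lemma isCentered_sect (hf : MemHatL2 n f) (hfc : IsCanonical n f) {k : ℕ} (hk : k ∈ B) :
    IsCentered boxLaw k (sect f B) := by
  by_cases hB : B.card = n
  swap
  · rw [sect_of_card_ne f hB]
    exact Eventually.of_forall fun x => by simp [resample]
  obtain _ | n := n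
  · simp [Finset.card_eq_zero.1 hB] at hk
  have card_erase : (B.erase k).card = n := by rw [Finset.card_erase_of_mem hk, hB]; simp
  set κ : Fin n → ℕ := ⇑((B.erase k).orderEmbOfFin card_erase) with hκ
  have injective_κ : Function.Injective κ := ((B.erase k).orderEmbOfFin card_erase).injective
  set e : Fin (n + 1) → Fin 1 ⊕ ℕ := Fin.cons (Sum.inl 0) fun j => Sum.inr (κ j) with he
  have injective_e : Function.Injective e :=
    Fin.cons_injective_iff.2 ⟨by simp, Sum.inr_injective.comp injective_κ⟩
  have inl_mem_range (a : Fin 1) : ∃ j, e j = Sum.inl a := ⟨0, by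
    rw [Subsingleton.elim a 0]; simp [he]⟩
  have pathIdx_e : pathIdx e = B.erase k := by
    ext b
    rw [mem_pathIdx, ← Finset.mem_coe, ← (B.erase k).range_orderEmbOfFin card_erase, ← hκ,
      Fin.exists_fin_succ]
    simp [he]
  have resample_eq := integral_mix_box hf injective_e inl_mem_range fun _ => k
  rw [pathIdx_e, Finset.image_const Finset.univ_nonempty, Finset.union_comm, ← Finset.insert_eq,
    Finset.insert_erase hk] at resample_eq
  filter_upwards [resample_eq, ae_comp_of_ae_leb (hfc k) injective_κ] with x resample_x hx
  rw [← resample_x, he, integral_mix_cons_boxLaw, hx, mul_zero, Pi.zero_apply]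

lemma boxTerm_ae_eq_sect (hf : MemHatL2 n f) (hfc : IsCanonical n f) (B : Finset ℕ) :
    boxTerm f B =ᵐ[pathLaw] sect f B :=
  centerPart_eq_self (integrable_sect hf.memLp B) fun _ hk => isCentered_sect hf hfc hk

end Centering

section Pairing

variable {n m : ℕ} (f : (Fin n → ℝ) → ℝ) (g : (Fin m → ℝ) → ℝ) (ψ : ℕ → ℝ → ℝ) (S : Finset ℕ)

/-- The pairing of the product of two sections with a test function. -/
def pairing (A B : Finset ℕ) : ℝ := ∫ x, sect f A x * sect g B x * testFn ψ S x ∂pathLaw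

/-- The pairing of the sections with indices `Z ∪ V` and `Z ∪ W`, provided that the indices in `Z`
lie outside of `S`; it is used with `V, W ⊆ S`. -/
def sharedPairing (V W Z : Finset ℕ) : ℝ :=
  if Disjoint Z S then pairing f g ψ S (Z ∪ V) (Z ∪ W) else 0

/-- The sum of the pairings over all sets of shared indices outside of `S`. -/
def totalPairing (V W : Finset ℕ) : ℝ := ∑' Z, sharedPairing f g ψ S V W Z

variable {f g ψ S} {A B V W Z : Finset ℕ}

lemma pairing_of_card_ne_left (hA : A.card ≠ n) : pairing f g ψ S A B = 0 := by
  simp [pairing, sect_of_card_ne f hA]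

lemma pairing_of_card_ne_right (hB : B.card ≠ m) : pairing f g ψ S A B = 0 := by
  simp [pairing, sect_of_card_ne g hB]

lemma integrable_sect_mul_sect_mul_testFn (hf : MemLp f 2 (leb n)) (hg : MemLp g 2 (leb m))
    (hψ : IsTest boxLaw ψ) (S A B : Finset ℕ) :
    Integrable (fun x => sect f A x * sect g B x * testFn ψ S x) pathLaw :=
  hψ.integrable_mul S ((memLp_sect hf A).integrable_mul (memLp_sect hg B))

-- An index belonging to exactly one of `A`, `B` and `S` makes the integral vanish, because the
-- factor depending on it is centered there.
lemma pairing_eq_zero (hf : MemHatL2 n f) (hfc : IsCanonical n f) (hg : MemHatL2 m g)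
    (hgc : IsCanonical m g) (hψ : IsTest boxLaw ψ) (h : ¬ (A \ S = B \ S ∧ S ⊆ A ∪ B)) :
    pairing f g ψ S A B = 0 := by
  have exists_unshared : (∃ k ∈ A, k ∉ B ∧ k ∉ S) ∨ (∃ k ∈ B, k ∉ A ∧ k ∉ S) ∨
      (∃ k ∈ S, k ∉ A ∧ k ∉ B) := by
    grind
  have dependsOn_f {k : ℕ} (hk : k ∉ A) : DependsOn (sect f A) {k}ᶜ :=
    (dependsOn_sect f A).mono (Set.subset_compl_singleton_iff.2 hk)
  have dependsOn_g {k : ℕ} (hk : k ∉ B) : DependsOn (sect g B) {k}ᶜ :=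
    (dependsOn_sect g B).mono (Set.subset_compl_singleton_iff.2 hk)
  have dependsOn_ψ {k : ℕ} (hk : k ∉ S) : DependsOn (testFn ψ S) {k}ᶜ :=
    (dependsOn_testFn ψ S).mono (Set.subset_compl_singleton_iff.2 hk)
  have integrable := integrable_sect_mul_sect_mul_testFn hf.memLp hg.memLp hψ S A B
  unfold pairing
  rcases exists_unshared with ⟨k, hkA, hkB, hkS⟩ | ⟨k, hkB, hkA, hkS⟩ | ⟨k, hkS, hkA, hkB⟩
  · simp only [mul_assoc] at integrable ⊢
    exact integral_mul_mul_eq_zero (isCentered_sect hf hfc hkA) (dependsOn_g hkB)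
      (dependsOn_ψ hkS) integrable
  · simp only [mul_assoc, mul_left_comm (sect f A _)] at integrable ⊢
    exact integral_mul_mul_eq_zero (isCentered_sect hg hgc hkB) (dependsOn_f hkA)
      (dependsOn_ψ hkS) integrable
  · simp only [mul_comm _ (testFn ψ S _)] at integrable ⊢
    exact integral_mul_mul_eq_zero (hψ.isCentered hkS) (dependsOn_f hkA) (dependsOn_g hkB)
      integrable

lemma summable_integral_sect_sq (hf : MemLp f 2 (leb n)) :
    Summable fun A => ∫ x, sect f A x ^ 2 ∂pathLaw := by
  have tsum_ne_top : ∑' A, eLpNorm (sect f A) 2 pathLaw ^ 2 ≠ ∞ :=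
    ne_top_of_le_ne_top (by have := hf.eLpNorm_ne_top; finiteness) (tsum_eLpNorm_sect_sq_le hf.1)
  refine (ENNReal.summable_toReal tsum_ne_top).congr fun A => ?_
  rw [ENNReal.toReal_pow, (memLp_sect hf A).eLpNorm_eq_integral_rpow_norm two_ne_zero (by norm_num),
    ENNReal.toReal_ofReal (by positivity), ← Real.rpow_mul_natCast (by positivity)]
  simp

lemma abs_pairing_le (hf : MemLp f 2 (leb n)) (hg : MemLp g 2 (leb m)) (hψ : IsTest boxLaw ψ)
    (A B : Finset ℕ) : |pairing f g ψ S A B| ≤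
      ∫ x, sect f A x ^ 2 ∂pathLaw + ∫ x, sect g B x ^ 2 ∂pathLaw := by
  have integrable_f_sq := (memLp_sect hf A).integrable_sq
  have integrable_g_sq := (memLp_sect hg B).integrable_sq
  rw [← integral_add integrable_f_sq integrable_g_sq, ← Real.norm_eq_abs]
  refine norm_integral_le_of_norm_le (integrable_f_sq.add integrable_g_sq)
    (Eventually.of_forall fun x => ?_)
  calc ‖sect f A x * sect g B x * testFn ψ S x‖
      ≤ |sect f A x * sect g B x| := by
        rw [norm_mul]
        exact mul_le_of_le_one_right (norm_nonneg _) (hψ.norm_testFn_le S x)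
    _ ≤ sect f A x ^ 2 + sect g B x ^ 2 := by
        rw [abs_mul, ← sq_abs (sect f A x), ← sq_abs (sect g B x)]
        nlinarith [two_mul_le_add_sq |sect f A x| |sect g B x|, abs_nonneg (sect f A x),
          abs_nonneg (sect g B x), mul_nonneg (abs_nonneg (sect f A x)) (abs_nonneg (sect g B x))]

lemma summable_sharedPairing (hf : MemLp f 2 (leb n)) (hg : MemLp g 2 (leb m))
    (hψ : IsTest boxLaw ψ) (hV : V ⊆ S) (hW : W ⊆ S) :
    Summable (sharedPairing f g ψ S V W) := by
  have summable_bound :=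
    ((summable_integral_sect_sq hf).comp_injective (symmDiff_left_injective V)).add
      ((summable_integral_sect_sq hg).comp_injective (symmDiff_left_injective W))
  refine Summable.of_norm_bounded summable_bound fun Z => ?_
  simp only [Function.comp_apply, sharedPairing]
  split_ifs with hZ
  · rw [(hZ.mono_right hV).symmDiff_eq_sup, (hZ.mono_right hW).symmDiff_eq_sup]
    exact abs_pairing_le hf hg hψ _ _
  · rw [norm_zero]
    exact add_nonneg (integral_nonneg fun x => sq_nonneg _) (integral_nonneg fun x => sq_nonneg _)

lemma sum_pairing_eq (hf : MemHatL2 n f) (hfc : IsCanonical n f) (hg : MemHatL2 m g)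
    (hgc : IsCanonical m g) (hψ : IsTest boxLaw ψ) {R : Finset ℕ} (hR : S ⊆ R) :
    ∑ q ∈ R.powerset ×ˢ R.powerset, pairing f g ψ S q.1 q.2 =
      ∑ q ∈ S.powerset ×ˢ S.powerset, ∑ Z ∈ R.powerset, sharedPairing f g ψ S q.1 q.2 Z := by
  have sum_filter_pairing : ∑ q ∈ R.powerset ×ˢ R.powerset with q.1 \ S = q.2 \ S,
      pairing f g ψ S q.1 q.2 = ∑ q ∈ R.powerset ×ˢ R.powerset, pairing f g ψ S q.1 q.2 :=
    Finset.sum_filter_of_ne fun q _ hq => by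
      by_contra h
      exact hq (pairing_eq_zero hf hfc hg hgc hψ fun h' => h h'.1)
  rw [← Finset.sum_product', ← sum_filter_pairing]
  simp only [sharedPairing]
  rw [← Finset.sum_filter]
  refine Finset.sum_nbij' (fun p => ((p.1 ∩ S, p.2 ∩ S), p.1 \ S))
    (fun q => (q.2 ∪ q.1.1, q.2 ∪ q.1.2)) ?_ ?_ ?_ ?_ ?_ <;>
  simp only [Finset.mem_filter, Finset.mem_product, Finset.mem_powerset,
    Finset.disjoint_left]
  · grind
  · grind
  · rintro ⟨A, B⟩ ⟨-, hAB⟩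
    rw [Finset.sdiff_union_inter, hAB, Finset.sdiff_union_inter]
  · rintro ⟨⟨V, W⟩, Z⟩ ⟨⟨⟨hV, hW⟩, -⟩, hZ⟩
    simp only [Prod.mk.injEq, Finset.ext_iff]
    grind
  · rintro ⟨A, B⟩ ⟨-, hAB⟩
    rw [Finset.sdiff_union_inter, hAB, Finset.sdiff_union_inter]

lemma integral_mul_mul_testFn (hf : MemHatL2 n f) (hfc : IsCanonical n f) (hg : MemHatL2 m g)
    (hgc : IsCanonical m g) (hψ : IsTest boxLaw ψ) (S : Finset ℕ) {Y Z : (ℕ → ℝ) → ℝ}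
    (hY : IsPathLimit f Y) (hZ : IsPathLimit g Z) :
    ∫ x, Y x * Z x * testFn ψ S x ∂pathLaw =
      (n ! * m ! : ℝ) * ∑ q ∈ S.powerset ×ˢ S.powerset, totalPairing f g ψ S q.1 q.2 := by
  have lim := tendsto_integral_mul_mul (memLp_partialIntegral hf.memLp)
    (memLp_partialIntegral hg.memLp) hY.memLp hZ.memLp
    (hψ.measurable_testFn S).aestronglyMeasurable (hψ.norm_testFn_le S) hY.tendsto hZ.tendsto
  have lim_sharedPairing : Tendsto (fun M => (n ! * m ! : ℝ) * ∑ q ∈ S.powerset ×ˢ S.powerset,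
      ∑ Z ∈ (Finset.range M).powerset, sharedPairing f g ψ S q.1 q.2 Z) atTop
      (𝓝 ((n ! * m ! : ℝ) * ∑ q ∈ S.powerset ×ˢ S.powerset, totalPairing f g ψ S q.1 q.2)) := by
    refine (tendsto_finsetSum _ fun q hq => ?_).const_mul _
    rw [Finset.mem_product, Finset.mem_powerset, Finset.mem_powerset] at hq
    exact (summable_sharedPairing hf.memLp hg.memLp hψ hq.1 hq.2).hasSum.comp tendsto_powerset_range
  refine tendsto_nhds_unique lim (lim_sharedPairing.congr' ?_)
  obtain ⟨N, hN⟩ := S.exists_nat_subset_range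
  filter_upwards [eventually_ge_atTop N] with M hM
  have integrand_eq : ∀ᵐ x ∂pathLaw,
      partialIntegral M f x * partialIntegral M g x * testFn ψ S x =
        (n ! * m ! : ℝ) * ∑ q ∈ (Finset.range M).powerset ×ˢ (Finset.range M).powerset,
          sect f q.1 x * sect g q.2 x * testFn ψ S x := by
    filter_upwards [ae_all_iff.2 fun B => boxTerm_ae_eq_sect hf hfc B,
      ae_all_iff.2 fun B => boxTerm_ae_eq_sect hg hgc B] with x hfx hgx
    simp only [partialIntegral, Pi.smul_apply, Finset.sum_apply, smul_eq_mul, hfx, hgx]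
    rw [← Finset.sum_mul, Finset.sum_product]
    dsimp only
    rw [← Finset.sum_mul_sum]
    ring
  rw [← sum_pairing_eq hf hfc hg hgc hψ (hN.trans (Finset.range_mono hM)),
    integral_congr_ae integrand_eq, integral_const_mul, integral_finsetSum _ fun q _ =>
    integrable_sect_mul_sect_mul_testFn hf.memLp hg.memLp hψ S q.1 q.2]
  rfl

end Pairing

/-! ### Counting coverings -/

section Counting

variable {α β : Type*} [DecidableEq α] [DecidableEq β]

/-- The coverings of `S` by two sets with `a` and `b` elements. -/
def coverPairs (S : Finset α) (a b : ℕ) : Finset (Finset α × Finset α) :=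
  {q ∈ S.powerset ×ˢ S.powerset | q.1.card = a ∧ q.2.card = b ∧ q.1 ∪ q.2 = S}

lemma mem_coverPairs {S : Finset α} {a b : ℕ} {q : Finset α × Finset α} :
    q ∈ coverPairs S a b ↔ q.1.card = a ∧ q.2.card = b ∧ q.1 ∪ q.2 = S := by
  simp only [coverPairs, Finset.mem_filter, Finset.mem_product, Finset.mem_powerset,
    and_iff_right_iff_imp]
  rintro ⟨-, -, rfl⟩
  exact ⟨Finset.subset_union_left, Finset.subset_union_right⟩

lemma sum_coverPairs_map {M : Type*} [AddCommMonoid M] (ι : α ↪ β) (S : Finset α) (a b : ℕ)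
    (H : Finset β → Finset β → M) :
    ∑ q ∈ coverPairs (S.map ι) a b, H q.1 q.2 =
      ∑ q ∈ coverPairs S a b, H (q.1.map ι) (q.2.map ι) := by
  symm
  refine Finset.sum_nbij (fun q => (q.1.map ι, q.2.map ι)) (fun q hq => ?_)
    (fun q _ q' _ h => ?_) (fun q hq => ?_) fun _ _ => rfl
  · obtain ⟨card_left, card_right, union_eq⟩ := mem_coverPairs.1 hq
    exact mem_coverPairs.2 ⟨by simpa using card_left, by simpa using card_right, by
      rw [← union_eq, Finset.map_union]⟩
  · simpa [Prod.ext_iff] using h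
  · obtain ⟨card_left, card_right, union_eq⟩ := mem_coverPairs.1 (Finset.mem_coe.1 hq)
    obtain ⟨V, -, hV⟩ := Finset.subset_map_iff.1 (Finset.subset_union_left.trans union_eq.subset)
    obtain ⟨W, -, hW⟩ := Finset.subset_map_iff.1 (Finset.subset_union_right.trans union_eq.subset)
    rw [hV, Finset.card_map] at card_left
    rw [hW, Finset.card_map] at card_right
    rw [hV, hW, ← Finset.map_union, Finset.map_inj] at union_eq
    exact ⟨(V, W), Finset.mem_coe.2 (mem_coverPairs.2 ⟨card_left, card_right, union_eq⟩),
      Prod.ext hV.symm hW.symm⟩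

/-- The membership pattern of a point with respect to two sets. -/
def pattern (V W : Finset α) (a : α) : Bool × Bool := (decide (a ∈ V), decide (a ∈ W))

variable {V W D E : Finset α}

lemma map_eq_iff_pattern (σ : Equiv.Perm α) :
    (D.map σ.toEmbedding = V ∧ E.map σ.toEmbedding = W) ↔ pattern V W ∘ σ = pattern D E := by
  have map_eq_iff (A B : Finset α) : A.map σ.toEmbedding = B ↔ ∀ a, σ a ∈ B ↔ a ∈ A := by
    rw [Finset.ext_iff, ← σ.forall_congr_right]
    simp [iff_comm]
  simp only [map_eq_iff, funext_iff, Function.comp_apply, pattern, Prod.mk.injEq, decide_eq_decide,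
    forall_and]

variable [Fintype α]

lemma card_pattern (h : V ∪ W = Finset.univ) (b : Bool × Bool) :
    Fintype.card {a // pattern V W a = b} =
      if b.1 then (if b.2 then (V ∩ W).card else (V \ W).card)
      else (if b.2 then (W \ V).card else 0) := by
  have mem_or_mem (a : α) : a ∈ V ∨ a ∈ W := Finset.mem_union.1 (h ▸ Finset.mem_univ a)
  rw [Fintype.card_subtype]
  obtain ⟨_ | _, _ | _⟩ := b <;>
  simp only [pattern, Prod.mk.injEq, decide_eq_true_eq, decide_eq_false_iff_not, if_true,
    Bool.false_eq_true, if_false]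
  · rw [Finset.card_eq_zero, Finset.filter_eq_empty_iff]
    exact fun a _ ha => (mem_or_mem a).elim ha.1 ha.2
  all_goals congr 1; ext a; simp [and_comm]

lemma card_perm_map_eq (h : V ∪ W = Finset.univ) (hDE : D ∪ E = Finset.univ)
    (hV : V.card = D.card) (hW : W.card = E.card) :
    (Finset.univ.filter fun σ : Equiv.Perm α =>
      D.map σ.toEmbedding = V ∧ E.map σ.toEmbedding = W).card =
      (D ∩ E).card ! * (D \ E).card ! * (E \ D).card ! := by
  have card_pattern_eq (b : Bool × Bool) : Fintype.card {a // pattern D E a = b} =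
      Fintype.card {a // pattern V W a = b} := by
    have card_inter : (D ∩ E).card = (V ∩ W).card := by
      have card_VW := Finset.card_union_add_card_inter V W
      have card_DE := Finset.card_union_add_card_inter D E
      rw [h] at card_VW
      rw [hDE] at card_DE
      omega
    rw [card_pattern h, card_pattern hDE, Finset.card_sdiff, Finset.card_sdiff, Finset.card_sdiff,
      Finset.card_sdiff, Finset.inter_comm E D, Finset.inter_comm W V, hV, hW, card_inter]
  let τ : Equiv.Perm α := Equiv.ofFiberEquiv fun b => Fintype.equivOfCardEq (card_pattern_eq b)
  have pattern_comp_τ : pattern V W ∘ τ = pattern D E :=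
    funext (Equiv.ofFiberEquiv_map fun b => Fintype.equivOfCardEq (card_pattern_eq b))
  have equivStabilizer : {σ : Equiv.Perm α // pattern V W ∘ σ = pattern D E} ≃
      {σ : Equiv.Perm α // pattern D E ∘ σ = pattern D E} :=
    Equiv.subtypeEquiv (Equiv.mulLeft τ⁻¹) fun σ => by
      rw [← pattern_comp_τ, Function.comp_assoc]
      simp [← Equiv.Perm.coe_mul]
  simp only [map_eq_iff_pattern]
  rw [← Fintype.card_subtype, Fintype.card_congr equivStabilizer, DomMulAct.stabilizer_card,
    Fintype.prod_prod_type]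
  simp only [Fintype.prod_bool, card_pattern hDE]
  simp

lemma sum_perm_map (hDE : D ∪ E = Finset.univ) (H : Finset α → Finset α → ℝ) :
    ∑ σ : Equiv.Perm α, H (D.map σ.toEmbedding) (E.map σ.toEmbedding) =
      ((D ∩ E).card ! * (D \ E).card ! * (E \ D).card ! : ℕ) *
        ∑ q ∈ coverPairs Finset.univ D.card E.card, H q.1 q.2 := by
  have map_mem_coverPairs : ∀ σ ∈ (Finset.univ : Finset (Equiv.Perm α)),
      (D.map σ.toEmbedding, E.map σ.toEmbedding) ∈
        coverPairs Finset.univ D.card E.card := fun σ _ =>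
    mem_coverPairs.2 ⟨Finset.card_map _, Finset.card_map _, by
      rw [← Finset.map_union, hDE, Finset.map_univ_equiv]⟩
  rw [← Finset.sum_fiberwise_of_maps_to map_mem_coverPairs, Finset.mul_sum]
  refine Finset.sum_congr rfl fun q hq => ?_
  obtain ⟨card_left, card_right, union_eq⟩ := mem_coverPairs.1 hq
  rw [← card_perm_map_eq union_eq hDE card_left card_right, ← nsmul_eq_mul, ← Finset.sum_const]
  simp only [Prod.ext_iff]
  refine Finset.sum_congr rfl fun σ hσ => ?_
  obtain ⟨map_D, map_E⟩ := (Finset.mem_filter.1 hσ).2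
  rw [map_D, map_E]

end Counting

lemma factorial_mul_choose_mul_choose {n m k i : ℕ} (hkn : k ≤ n) (hkm : k ≤ m) (hik : i ≤ k) :
    k ! * m.choose k * n.choose k * (k.choose i * (i ! * ((k - i)! * (n - k)! * (m - k)!))) =
      n ! * m ! := by
  calc _ = (k.choose i * i ! * (k - i)!) * (m.choose k * (m - k)!) *
        (n.choose k * k ! * (n - k)!) := by ring
    _ = n ! * m ! := by
        rw [Nat.choose_mul_factorial_mul_factorial hik, Nat.choose_mul_factorial_mul_factorial hkn,
          mul_comm, ← Nat.choose_mul_factorial_mul_factorial hkm]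
        ring

lemma sum_sum_coverPairs {α M : Type*} [DecidableEq α] [AddCommMonoid M] {n m : ℕ} {S : Finset α}
    {Θ : Finset α → Finset α → M}
    (hΘ : ∀ V W, V ⊆ S → W ⊆ S → Θ V W ≠ 0 →
      V ∪ W = S ∧ ∃ i, V.card + i = n ∧ W.card + i = m) :
    ∑ k ∈ Finset.range (min m n + 1), ∑ i ∈ Finset.range (k + 1),
      (if S.card = m + n - k - i then ∑ q ∈ coverPairs S (n - i) (m - i), Θ q.1 q.2 else 0) =
      ∑ q ∈ S.powerset ×ˢ S.powerset, Θ q.1 q.2 := by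
  have sum_coverPairs_eq (k i : ℕ) :
      (if S.card = m + n - k - i then ∑ q ∈ coverPairs S (n - i) (m - i), Θ q.1 q.2 else 0) =
        ∑ q ∈ S.powerset ×ˢ S.powerset, if S.card = m + n - k - i ∧ q.1.card = n - i ∧
          q.2.card = m - i ∧ q.1 ∪ q.2 = S then Θ q.1 q.2 else 0 := by
    split_ifs with hS
    · simp only [hS, true_and, coverPairs, Finset.sum_filter]
    · simp [hS]
  simp only [sum_coverPairs_eq]
  simp only [Finset.sum_comm (s := Finset.range _) (t := S.powerset ×ˢ S.powerset)]
  refine Finset.sum_congr rfl fun q hq => ?_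
  rw [Finset.mem_product, Finset.mem_powerset, Finset.mem_powerset] at hq
  by_cases hq0 : Θ q.1 q.2 = 0
  · simp [hq0]
  obtain ⟨union_eq, i, card_left, card_right⟩ := hΘ _ _ hq.1 hq.2 hq0
  have card_le_left := Finset.card_le_card hq.1
  have card_le_right := Finset.card_le_card hq.2
  have card_le_add := Finset.card_union_le q.1 q.2
  rw [union_eq] at card_le_add
  rw [Finset.sum_eq_single_of_mem (m + n - i - S.card) (Finset.mem_range.2 (by omega)),
    Finset.sum_eq_single_of_mem i (Finset.mem_range.2 (by omega)),
    if_pos ⟨by omega, by omega, by omega, union_eq⟩]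
  · exact fun j hj hji => if_neg (by rw [Finset.mem_range] at hj; omega)
  · refine fun k hk hne => Finset.sum_eq_zero fun j hj => if_neg ?_
    rw [Finset.mem_range] at hk hj
    omega

/-! ### Contractions -/

section MixedPairing

variable {n m i : ℕ} {f : (Fin n → ℝ) → ℝ} {g : (Fin m → ℝ) → ℝ} {ψ : ℕ → ℝ → ℝ}
  {S V W Z : Finset ℕ} {e : Fin n → Fin i ⊕ ℕ} {e' : Fin m → Fin i ⊕ ℕ} {ζ : Fin i → ℕ}

lemma card_pathIdx (he : Function.Injective e) (hl : ∀ a, ∃ j, e j = Sum.inl a) :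
    (pathIdx e).card + i = n := by
  have toLeft_eq : (Finset.univ.image e).toLeft = Finset.univ := by
    ext a
    simpa using hl a
  have := Finset.card_toLeft_add_card_toRight (u := Finset.univ.image e)
  rw [toLeft_eq, Finset.card_image_of_injective _ he, Finset.card_fin, Finset.card_fin] at this
  rw [pathIdx, add_comm, this]

lemma memLp_mix_box (hf : MemLp f 2 (leb n)) (he : Function.Injective e) (ζ : Fin i → ℕ) :
    MemLp (fun q : (Fin i → ℝ) × (ℕ → ℝ) => f (mix e q.1 q.2)) 2
      ((Measure.pi fun a => boxLaw (ζ a)).prod pathLaw) :=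
  (hf.mono_measure (pi_boxLaw_le_leb _)).comp_measurePreserving (measurePreserving_mix he ζ)

lemma mix_ae_eq_zero (hf : MemHatL2 n f) (he : Function.Injective e)
    (hζ : ¬ Function.Injective (mixIdx e ζ)) :
    ∀ᵐ q ∂(Measure.pi fun a => boxLaw (ζ a)).prod pathLaw, f (mix e q.1 q.2) = 0 :=
  (measurePreserving_mix he ζ).quasiMeasurePreserving.ae
    (ae_eq_zero_of_not_injective hf.vanish hζ)

lemma IsTest.integrable_mul_snd (hψ : IsTest boxLaw ψ) (S : Finset ℕ) {α : Type*}
    [MeasurableSpace α] {ν : Measure α} {H : α × (ℕ → ℝ) → ℝ}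
    (hH : Integrable H (ν.prod pathLaw)) :
    Integrable (fun q => H q * testFn ψ S q.2) (ν.prod pathLaw) :=
  hH.mul_bdd ((hψ.measurable_testFn S).comp measurable_snd).aestronglyMeasurable
    (Eventually.of_forall fun q => hψ.norm_testFn_le S q.2)

lemma integral_mix_mul_mix_box_of_injective (hf : MemHatL2 n f) (hg : MemHatL2 m g)
    (hψ : IsTest boxLaw ψ) (he : Function.Injective e) (he' : Function.Injective e')
    (hl : ∀ a, ∃ j, e j = Sum.inl a) (hl' : ∀ a, ∃ j, e' j = Sum.inl a)
    (hζ : Function.Injective (mixIdx e ζ)) (hζ' : Function.Injective (mixIdx e' ζ))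
    (hdisj : Disjoint (Finset.univ.image ζ) S) :
    ∫ q, f (mix e q.1 q.2) * g (mix e' q.1 q.2) * testFn ψ S q.2
      ∂((Measure.pi fun a => boxLaw (ζ a)).prod pathLaw) =
      pairing f g ψ S (Finset.univ.image ζ ∪ pathIdx e) (Finset.univ.image ζ ∪ pathIdx e') := by
  set C := Finset.univ.image ζ
  set Φ : (ℕ → ℝ) → ℝ := fun w =>
    f (fun j => w (mixIdx e ζ j)) * g (fun j => w (mixIdx e' ζ j)) * testFn ψ S w with hΦ
  have Φ_ae_eq : Φ =ᵐ[pathLaw] fun x =>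
      sect f (C ∪ pathIdx e) x * sect g (C ∪ pathIdx e') x * testFn ψ S x := by
    have f_ae_eq := comp_ae_eq_sect hf.symmetric hζ
    have g_ae_eq := comp_ae_eq_sect hg.symmetric hζ'
    rw [image_mixIdx hl, Finset.union_comm] at f_ae_eq
    rw [image_mixIdx hl', Finset.union_comm] at g_ae_eq
    filter_upwards [f_ae_eq, g_ae_eq] with x hfx hgx
    simp only [hΦ, hfx, hgx]
    rfl
  have integrable_Φ : Integrable Φ pathLaw :=
    (integrable_sect_mul_sect_mul_testFn hf.memLp hg.memLp hψ S _ _).congr Φ_ae_eq.symm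
  have integrable_mix := hψ.integrable_mul_snd S
    ((memLp_mix_box hf.memLp he ζ).integrable_mul (memLp_mix_box hg.memLp he' ζ))
  simp only [Pi.mul_apply] at integrable_mix
  have comp_preserving := measurePreserving_comp (injective_of_mixIdx hl hζ)
  have testFn_piecewise (x y : ℕ → ℝ) : testFn ψ S (C.piecewise y x) = testFn ψ S x :=
    dependsOn_testFn ψ S fun k hk =>
      Finset.piecewise_eq_of_notMem _ _ _ (Finset.disjoint_right.1 hdisj hk)
  rw [pairing, ← integral_congr_ae Φ_ae_eq, ← integral_resample integrable_Φ C,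
    integral_prod_symm _ integrable_mix]
  refine integral_congr_ae ?_
  filter_upwards [integrable_mix.prod_left_ae] with x hx
  have aesm_x := hx.1
  rw [← comp_preserving.map_eq] at aesm_x ⊢
  rw [integral_map comp_preserving.measurable.aemeasurable aesm_x]
  simp only [resample, hΦ, mix_eq_piecewise hl hζ, mix_eq_piecewise hl' hζ', testFn_piecewise]
  rfl

lemma integral_mix_mul_mix_box (hf : MemHatL2 n f) (hg : MemHatL2 m g) (hψ : IsTest boxLaw ψ)
    (he : Function.Injective e) (he' : Function.Injective e')
    (hl : ∀ a, ∃ j, e j = Sum.inl a) (hl' : ∀ a, ∃ j, e' j = Sum.inl a)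
    (hS : pathIdx e ∪ pathIdx e' = S) (ζ : Fin i → ℕ) :
    ∫ q, f (mix e q.1 q.2) * g (mix e' q.1 q.2) * testFn ψ S q.2
      ∂((Measure.pi fun a => boxLaw (ζ a)).prod pathLaw) =
      sharedPairing f g ψ S (pathIdx e) (pathIdx e') (Finset.univ.image ζ) := by
  rw [sharedPairing]
  by_cases hζ : Function.Injective (mixIdx e ζ)
  swap
  · have card_ne : (Finset.univ.image ζ ∪ pathIdx e).card ≠ n := by
      rwa [Finset.union_comm, ← image_mixIdx hl, Ne, card_image_eq_iff]
    rw [pairing_of_card_ne_left card_ne, ite_self]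
    refine integral_eq_zero_of_ae ?_
    filter_upwards [mix_ae_eq_zero hf he hζ] with q hq
    simp [hq]
  by_cases hζ' : Function.Injective (mixIdx e' ζ)
  swap
  · have card_ne : (Finset.univ.image ζ ∪ pathIdx e').card ≠ m := by
      rwa [Finset.union_comm, ← image_mixIdx hl', Ne, card_image_eq_iff]
    rw [pairing_of_card_ne_right card_ne, ite_self]
    refine integral_eq_zero_of_ae ?_
    filter_upwards [mix_ae_eq_zero hg he' hζ'] with q hq
    simp [hq]
  have hdisj : Disjoint (Finset.univ.image ζ) S := by
    rw [← hS, Finset.disjoint_union_right]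
    exact ⟨disjoint_image_pathIdx hl hζ, disjoint_image_pathIdx hl' hζ'⟩
  rw [if_pos hdisj,
    integral_mix_mul_mix_box_of_injective hf hg hψ he he' hl hl' hζ hζ' hdisj]

lemma card_eq_of_sharedPairing_ne_zero (hV : V ⊆ S) (hW : W ⊆ S)
    (h : sharedPairing f g ψ S V W Z ≠ 0) : V.card + Z.card = n ∧ W.card + Z.card = m := by
  obtain ⟨hdisj, pairing_ne⟩ : Disjoint Z S ∧ pairing f g ψ S (Z ∪ V) (Z ∪ W) ≠ 0 := by
    simpa [sharedPairing] using h
  have card_left := not_imp_comm.1 pairing_of_card_ne_left pairing_ne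
  have card_right := not_imp_comm.1 pairing_of_card_ne_right pairing_ne
  rw [Finset.card_union_of_disjoint (hdisj.mono_right hV)] at card_left
  rw [Finset.card_union_of_disjoint (hdisj.mono_right hW)] at card_right
  omega

lemma integral_mix_mul_mix (hf : MemHatL2 n f) (hg : MemHatL2 m g) (hψ : IsTest boxLaw ψ)
    (he : Function.Injective e) (he' : Function.Injective e')
    (hl : ∀ a, ∃ j, e j = Sum.inl a) (hl' : ∀ a, ∃ j, e' j = Sum.inl a)
    (hS : pathIdx e ∪ pathIdx e' = S) :
    ∫ x, (∫ z, f (mix e z x) * g (mix e' z x) ∂leb i) * testFn ψ S x ∂pathLaw =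
      2 ^ i * (i ! * totalPairing f g ψ S (pathIdx e) (pathIdx e')) := by
  have left_subset : pathIdx e ⊆ S := hS ▸ Finset.subset_union_left
  have right_subset : pathIdx e' ⊆ S := hS ▸ Finset.subset_union_right
  have integrable_mix := hψ.integrable_mul_snd S
    ((memLp_comp_mix he hl hf.memLp).integrable_mul (memLp_comp_mix he' hl' hg.memLp))
  simp only [Pi.mul_apply] at integrable_mix
  have prod_eq_sum : (leb i).prod pathLaw = Measure.sum fun ζ : Fin i → ℕ =>
      (2 ^ i : ℝ≥0∞) • ((Measure.pi fun a => boxLaw (ζ a)).prod pathLaw) := by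
    simp only [leb_eq_sum, Measure.prod_sum_left, Measure.prod_smul_left]
  have sharedPairing_eq_zero (Z : Finset ℕ) (hZ : Z.card ≠ i) :
      sharedPairing f g ψ S (pathIdx e) (pathIdx e') Z = 0 := by
    by_contra h
    have := card_eq_of_sharedPairing_ne_zero left_subset right_subset h
    have := card_pathIdx he hl
    omega
  simp only [← integral_mul_const]
  rw [totalPairing, ← tsum_tuple (summable_sharedPairing hf.memLp hg.memLp hψ left_subset
    right_subset) sharedPairing_eq_zero, ← integral_prod_symm _ integrable_mix]
  rw [prod_eq_sum] at integrable_mix ⊢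
  rw [integral_sum_measure integrable_mix, ← tsum_mul_left]
  refine tsum_congr fun ζ => ?_
  simp only [integral_smul_measure,
    integral_mix_mul_mix_box hf hg hψ he he' hl hl' hS]
  simp

lemma totalPairing_ne_zero (hf : MemHatL2 n f) (hfc : IsCanonical n f) (hg : MemHatL2 m g)
    (hgc : IsCanonical m g) (hψ : IsTest boxLaw ψ) (hV : V ⊆ S) (hW : W ⊆ S)
    (h : totalPairing f g ψ S V W ≠ 0) :
    V ∪ W = S ∧ ∃ i, V.card + i = n ∧ W.card + i = m := by
  obtain ⟨Z, hZ⟩ : ∃ Z, sharedPairing f g ψ S V W Z ≠ 0 := by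
    by_contra! hc
    exact h (by simp [totalPairing, hc])
  refine ⟨?_, Z.card, card_eq_of_sharedPairing_ne_zero hV hW hZ⟩
  obtain ⟨hdisj, pairing_ne⟩ : Disjoint Z S ∧ pairing f g ψ S (Z ∪ V) (Z ∪ W) ≠ 0 := by
    simpa [sharedPairing] using hZ
  have S_subset := (not_imp_comm.1 (pairing_eq_zero hf hfc hg hgc hψ) pairing_ne).2
  refine Finset.Subset.antisymm (Finset.union_subset hV hW) fun k hk => ?_
  have k_notMem := Finset.disjoint_right.1 hdisj hk
  have k_mem := S_subset hk
  simp only [Finset.mem_union] at k_mem ⊢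
  tauto

end MixedPairing

section Contraction

variable {n m k i : ℕ}

variable (n m k i) in
/-- The positions of the variables `(γ, t)` of `f` among the variables `(γ, t, s)` of the
contraction `f ⋆ₖⁱ g`. -/
def leftVars : Finset (Fin (m + n - k - i)) := {j | (j : ℕ) < n - i}

variable (n m k i) in
/-- The positions of the variables `(γ, s)` of `g` among the variables `(γ, t, s)` of the
contraction `f ⋆ₖⁱ g`. -/
def rightVars : Finset (Fin (m + n - k - i)) := {j | (j : ℕ) < k - i ∨ n - i ≤ (j : ℕ)}

lemma leftVars_union_rightVars : leftVars n m k i ∪ rightVars n m k i = Finset.univ := by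
  ext j
  simp only [leftVars, rightVars, Finset.mem_union, Finset.mem_filter_univ, Finset.mem_univ,
    iff_true]
  omega

lemma card_leftVars (hkm : k ≤ m) : (leftVars n m k i).card = n - i := by
  rw [leftVars, Fin.card_filter_val_lt]
  omega

lemma card_leftVars_inter_rightVars (hkm : k ≤ m) (hkn : k ≤ n) :
    (leftVars n m k i ∩ rightVars n m k i).card = k - i := by
  have inter_eq : leftVars n m k i ∩ rightVars n m k i =
      Finset.univ.filter fun j : Fin (m + n - k - i) => (j : ℕ) < k - i := by
    ext j
    simp only [leftVars, rightVars, Finset.mem_inter, Finset.mem_filter_univ]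
    omega
  rw [inter_eq, Fin.card_filter_val_lt]
  omega

lemma card_leftVars_sdiff_rightVars (hik : i ≤ k) (hkm : k ≤ m) (hkn : k ≤ n) :
    (leftVars n m k i \ rightVars n m k i).card = n - k := by
  have := Finset.card_sdiff_add_card_inter (leftVars n m k i) (rightVars n m k i)
  rw [card_leftVars hkm, card_leftVars_inter_rightVars hkm hkn] at this
  omega

lemma card_rightVars (hik : i ≤ k) (hkm : k ≤ m) (hkn : k ≤ n) :
    (rightVars n m k i).card = m - i := by
  have := Finset.card_union_add_card_inter (leftVars n m k i) (rightVars n m k i)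
  rw [leftVars_union_rightVars, Finset.card_fin, card_leftVars hkm,
    card_leftVars_inter_rightVars hkm hkn] at this
  omega

lemma card_rightVars_sdiff_leftVars (hik : i ≤ k) (hkm : k ≤ m) (hkn : k ≤ n) :
    (rightVars n m k i \ leftVars n m k i).card = m - k := by
  have := Finset.card_sdiff_add_card_inter (rightVars n m k i) (leftVars n m k i)
  rw [Finset.inter_comm, card_rightVars hik hkm hkn, card_leftVars_inter_rightVars hkm hkn] at this
  omega

/-- The arguments `(z, γ, t)` of `f` in the contraction `f ⋆ₖⁱ g`, the variables `(γ, t, s)` being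
the coordinates of a path with the indices `ρ`. -/
def leftPattern (hkm : k ≤ m) (ρ : Fin (m + n - k - i) → ℕ) (j : Fin n) : Fin i ⊕ ℕ :=
  if h : (j : ℕ) < i then Sum.inl ⟨j, h⟩ else Sum.inr (ρ ⟨j - i, by omega⟩)

/-- The arguments `(z, γ, s)` of `g` in the contraction `f ⋆ₖⁱ g`, the variables `(γ, t, s)` being
the coordinates of a path with the indices `ρ`. -/
def rightPattern (hik : i ≤ k) (hkn : k ≤ n) (ρ : Fin (m + n - k - i) → ℕ) (j : Fin m) :
    Fin i ⊕ ℕ :=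
  if h : (j : ℕ) < i then Sum.inl ⟨j, h⟩
  else if h' : (j : ℕ) < k then Sum.inr (ρ ⟨j - i, by omega⟩)
  else Sum.inr (ρ ⟨n - i + (j - k), by omega⟩)

variable (hik : i ≤ k) (hkm : k ≤ m) (hkn : k ≤ n) {ρ : Fin (m + n - k - i) → ℕ}

lemma injective_leftPattern (hρ : Function.Injective ρ) :
    Function.Injective (leftPattern hkm ρ) := by
  intro a b hab
  unfold leftPattern at hab
  split_ifs at hab
  · simpa [Fin.ext_iff] using hab
  · have := hρ (Sum.inr_injective hab)
    simp only [Fin.mk.injEq] at this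
    omega

lemma injective_rightPattern (hρ : Function.Injective ρ) :
    Function.Injective (rightPattern hik hkn ρ) := by
  intro a b hab
  unfold rightPattern at hab
  split_ifs at hab
  · simpa [Fin.ext_iff] using hab
  all_goals
    have := hρ (Sum.inr_injective hab)
    simp only [Fin.mk.injEq] at this
    omega

lemma exists_leftPattern_eq_inl (hin : i ≤ n) (a : Fin i) :
    ∃ j : Fin n, leftPattern hkm ρ j = Sum.inl a :=
  ⟨⟨a, by omega⟩, by simp [leftPattern]⟩

lemma exists_rightPattern_eq_inl (him : i ≤ m) (a : Fin i) :
    ∃ j : Fin m, rightPattern hik hkn ρ j = Sum.inl a :=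
  ⟨⟨a, by omega⟩, by simp [rightPattern]⟩

lemma pathIdx_leftPattern : pathIdx (leftPattern hkm ρ) = (leftVars n m k i).image ρ := by
  ext b
  simp only [mem_pathIdx, leftVars, Finset.mem_image, Finset.mem_filter_univ]
  constructor
  · rintro ⟨j, hj⟩
    unfold leftPattern at hj
    split_ifs at hj
    exact ⟨_, by simp only; omega, Sum.inr_injective hj⟩
  · rintro ⟨l, hl, rfl⟩
    exact ⟨⟨l + i, by omega⟩, by simp [leftPattern]⟩

include hkm in
lemma pathIdx_rightPattern :
    pathIdx (rightPattern hik hkn ρ) = (rightVars n m k i).image ρ := by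
  ext b
  simp only [mem_pathIdx, rightVars, Finset.mem_image, Finset.mem_filter_univ]
  constructor
  · rintro ⟨j, hj⟩
    unfold rightPattern at hj
    split_ifs at hj
    all_goals exact ⟨_, by simp only; omega, Sum.inr_injective hj⟩
  · rintro ⟨l, hl | hl, rfl⟩
    · have : (l : ℕ) + i < k := by omega
      exact ⟨⟨l + i, by omega⟩, by simp [rightPattern, this]⟩
    · have not_lt : ¬ (l : ℕ) - (n - i) + k < i := by omega
      have add_sub : n - i + ((l : ℕ) - (n - i)) = l := by omega
      exact ⟨⟨l - (n - i) + k, by omega⟩, by simp [rightPattern, not_lt, add_sub]⟩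

variable {f : (Fin n → ℝ) → ℝ} {g : (Fin m → ℝ) → ℝ}

variable (ρ f g) in
lemma contraction_comp_eq (x : ℕ → ℝ) :
    contraction n m k i f g (fun j => x (ρ j)) =
      1 / 2 ^ i * ∫ z, f (mix (leftPattern hkm ρ) z x) *
        g (mix (rightPattern hik hkn ρ) z x) ∂leb i := by
  unfold contraction
  congr! 5 with z
  · funext j
    unfold mix leftPattern
    split_ifs with h
    · simp [coord, h]
    · have : (j : ℕ) - i < m + n - k - i := by omega
      simp [coord, this]
  · funext j
    unfold mix rightPattern
    split_ifs with h h'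
    · simp [coord, h]
    · have : (j : ℕ) - i < m + n - k - i := by omega
      simp [coord, this]
    · have : n - i + ((j : ℕ) - k) < m + n - k - i := by omega
      simp [coord, this]

lemma integral_contraction_mul_testFn {ψ : ℕ → ℝ → ℝ} (hik : i ≤ k) (hkm : k ≤ m) (hkn : k ≤ n)
    (hf : MemHatL2 n f) (hg : MemHatL2 m g) (hψ : IsTest boxLaw ψ) (hρ : Function.Injective ρ) :
    ∫ x, contraction n m k i f g (fun j => x (ρ j)) * testFn ψ (Finset.univ.image ρ) x ∂pathLaw =
      i ! * totalPairing f g ψ (Finset.univ.image ρ)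
        ((leftVars n m k i).image ρ) ((rightVars n m k i).image ρ) := by
  have union_eq : pathIdx (leftPattern hkm ρ) ∪ pathIdx (rightPattern hik hkn ρ) =
      Finset.univ.image ρ := by
    rw [pathIdx_leftPattern, pathIdx_rightPattern hik hkm hkn, ← Finset.image_union,
      leftVars_union_rightVars]
  simp only [contraction_comp_eq hik hkm hkn ρ f g, mul_assoc (1 / 2 ^ i : ℝ)]
  rw [integral_const_mul, integral_mix_mul_mix hf hg hψ (injective_leftPattern hkm hρ)
    (injective_rightPattern hik hkn hρ) (exists_leftPattern_eq_inl hkm (hik.trans hkn))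
    (exists_rightPattern_eq_inl hik hkn (hik.trans hkm)) union_eq, pathIdx_leftPattern,
    pathIdx_rightPattern hik hkm hkn]
  field_simp

end Contraction

section Kernel

variable {p : ℕ} {h : (Fin p → ℝ) → ℝ}

lemma measurePreserving_perm (σ : Equiv.Perm (Fin p)) :
    MeasurePreserving (fun (x : Fin p → ℝ) j => x (σ j)) (leb p) (leb p) :=
  (measurePreserving_piCongrLeft (fun _ => (volume : Measure ℝ).restrict (Set.Ici 0)) σ).symm

lemma measurableSet_offDiag (p : ℕ) : MeasurableSet (offDiag p) := by
  have offDiag_eq : offDiag p = ⋃ κ ∈ {κ : Fin p → ℕ | Function.Injective κ},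
      Set.univ.pi fun j => Set.Icc (2 * (κ j : ℝ)) (2 * (κ j : ℝ) + 2) := by
    ext x
    simp only [offDiag, Set.mem_ofPred_eq, Set.mem_iUnion, exists_prop, Set.mem_univ_pi]
  rw [offDiag_eq]
  exact MeasurableSet.biUnion (Set.to_countable _) fun κ _ =>
    MeasurableSet.univ_pi fun j => measurableSet_Icc

lemma mem_offDiag_perm (σ : Equiv.Perm (Fin p)) {x : Fin p → ℝ} :
    (fun j => x (σ j)) ∈ offDiag p ↔ x ∈ offDiag p := by
  have perm_mem (σ : Equiv.Perm (Fin p)) {x : Fin p → ℝ} :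
      x ∈ offDiag p → (fun j => x (σ j)) ∈ offDiag p := by
    rintro ⟨κ, hκ, hx⟩
    exact ⟨fun j => κ (σ j), hκ.comp σ.injective, fun j => hx (σ j)⟩
  exact ⟨fun hx => by simpa using perm_mem σ.symm hx, perm_mem σ⟩

lemma symmetrisation_perm (h : (Fin p → ℝ) → ℝ) (τ : Equiv.Perm (Fin p)) (x : Fin p → ℝ) :
    symmetrisation p h (fun j => x (τ j)) = symmetrisation p h x := by
  unfold symmetrisation
  congr 1
  exact Fintype.sum_equiv (Equiv.mulLeft τ) _ _ fun σ => by simp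

lemma memHatL2_indicator_symmetrisation (hh : MemLp h 2 (leb p)) :
    MemHatL2 p ((offDiag p).indicator (symmetrisation p h)) where
  memLp := .indicator (measurableSet_offDiag p) <|
    (memLp_finsetSum _ fun σ _ =>
      hh.comp_measurePreserving (measurePreserving_perm σ)).const_mul _
  symmetric τ := Eventually.of_forall fun x => by
    classical
    simp only [Set.indicator_apply, mem_offDiag_perm, symmetrisation_perm]
  vanish := Eventually.of_forall fun _ hx => Set.indicator_of_notMem hx _

lemma ae_mem_box : ∀ᵐ x ∂pathLaw, ∀ k : ℕ, x k ∈ Set.Icc (2 * (k : ℝ)) (2 * (k : ℝ) + 2) :=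
  ae_all_iff.2 fun k => (measurePreserving_eval_infinitePi boxLaw k).quasiMeasurePreserving.ae <|
    Measure.ae_smul_measure (ae_restrict_mem measurableSet_Icc) _

lemma integral_sect_symmetrisation (hh : MemLp h 2 (leb p)) {ψ : ℕ → ℝ → ℝ}
    (hψ : IsTest boxLaw ψ) {S : Finset ℕ} (hS : S.card = p) :
    p ! * ∫ x, sect ((offDiag p).indicator (symmetrisation p h)) S x * testFn ψ S x ∂pathLaw =
      ∑ σ : Equiv.Perm (Fin p),
        ∫ x, h (fun j => x (S.orderEmbOfFin hS (σ j))) * testFn ψ S x ∂pathLaw := by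
  have integrable_comp (σ : Equiv.Perm (Fin p)) :
      Integrable (fun x : ℕ → ℝ => h (fun j => x (S.orderEmbOfFin hS (σ j)))) pathLaw :=
    ((hh.mono_measure (pi_boxLaw_le_leb _)).comp_measurePreserving <| measurePreserving_comp <|
      (S.orderEmbOfFin hS).injective.comp σ.injective).integrable one_le_two
  have sect_ae_eq : ∀ᵐ x ∂pathLaw,
      sect ((offDiag p).indicator (symmetrisation p h)) S x * testFn ψ S x =
        1 / (p ! : ℝ) * ∑ σ : Equiv.Perm (Fin p),
          h (fun j => x (S.orderEmbOfFin hS (σ j))) * testFn ψ S x := by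
    filter_upwards [ae_mem_box] with x hx
    have mem_offDiag : (fun j => x (S.orderEmbOfFin hS j)) ∈ offDiag p :=
      ⟨_, (S.orderEmbOfFin hS).injective, fun j => hx _⟩
    simp only [sect_of_card _ hS]
    rw [Set.indicator_of_mem mem_offDiag, symmetrisation, mul_assoc,
      Finset.sum_mul]
  rw [integral_congr_ae sect_ae_eq, integral_const_mul,
    integral_finsetSum _ fun σ _ => hψ.integrable_mul S (integrable_comp σ)]
  field_simp

end Kernel

section Formula

variable {n m : ℕ} {f : (Fin n → ℝ) → ℝ} {g : (Fin m → ℝ) → ℝ}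

lemma integral_mul_testFn_of_isPathLimit_productKernel {k i : ℕ} (hik : i ≤ k) (hkm : k ≤ m)
    (hkn : k ≤ n) (hf : MemHatL2 n f) (hg : MemHatL2 m g)
    (hfg : MemLp (contraction n m k i f g) 2 (leb (m + n - k - i)))
    {Z : (ℕ → ℝ) → ℝ} (hZ : IsPathLimit (productKernel n m k i f g) Z)
    {ψ : ℕ → ℝ → ℝ} (hψ : IsTest boxLaw ψ) (S : Finset ℕ) :
    ∫ x, Z x * testFn ψ S x ∂pathLaw =
      (i ! * ((k - i)! * (n - k)! * (m - k)!) : ℕ) *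
        if S.card = m + n - k - i then
          ∑ q ∈ coverPairs S (n - i) (m - i), totalPairing f g ψ S q.1 q.2
        else 0 := by
  rw [hZ.integral_mul_testFn (memHatL2_indicator_symmetrisation hfg).memLp hψ S]
  split_ifs with hS
  swap
  · simp [sect_of_card_ne _ hS]
  set ι := (S.orderEmbOfFin hS).toEmbedding
  have map_univ : Finset.univ.map ι = S := Finset.map_orderEmbOfFin_univ S hS
  have integral_contraction (σ : Equiv.Perm (Fin (m + n - k - i))) :
      ∫ x, contraction n m k i f g (fun j => x (S.orderEmbOfFin hS (σ j))) * testFn ψ S x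
        ∂pathLaw = i ! * totalPairing f g ψ S
          (((leftVars n m k i).map σ.toEmbedding).map ι)
          (((rightVars n m k i).map σ.toEmbedding).map ι) := by
    have := integral_contraction_mul_testFn hik hkm hkn hf hg hψ
      ((S.orderEmbOfFin hS).injective.comp σ.injective)
    simp only [Function.comp_def, image_orderEmbOfFin_perm] at this
    rw [this, Finset.map_map, Finset.map_map, Finset.map_eq_image, Finset.map_eq_image]
    rfl
  refine (integral_sect_symmetrisation hfg hψ hS).trans ?_
  rw [Finset.sum_congr rfl fun σ _ => integral_contraction σ, ← Finset.mul_sum,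
    sum_perm_map leftVars_union_rightVars fun V W => totalPairing f g ψ S (V.map ι) (W.map ι),
    card_leftVars hkm, card_rightVars hik hkm hkn, card_leftVars_inter_rightVars hkm hkn,
    card_leftVars_sdiff_rightVars hik hkm hkn, card_rightVars_sdiff_leftVars hik hkm hkn,
    ← sum_coverPairs_map ι, map_univ]
  push_cast
  ring

variable {Y Y' : (ℕ → ℝ) → ℝ} {Z : ℕ → ℕ → (ℕ → ℝ) → ℝ}

lemma sum_integral_mul_testFn (hf : MemHatL2 n f) (hfc : IsCanonical n f) (hg : MemHatL2 m g)
    (hgc : IsCanonical m g)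
    (hfg : ∀ k i : ℕ, i ≤ k → k ≤ min m n →
      MemLp (contraction n m k i f g) 2 (leb (m + n - k - i)))
    (hZ : ∀ k i : ℕ, i ≤ k → k ≤ min m n → IsPathLimit (productKernel n m k i f g) (Z k i))
    {ψ : ℕ → ℝ → ℝ} (hψ : IsTest boxLaw ψ) (S : Finset ℕ) :
    ∑ k ∈ Finset.range (min m n + 1), ∑ i ∈ Finset.range (k + 1),
      (k ! * m.choose k * n.choose k * k.choose i : ℝ) * ∫ x, Z k i x * testFn ψ S x ∂pathLaw =
      (n ! * m ! : ℝ) * ∑ q ∈ S.powerset ×ˢ S.powerset, totalPairing f g ψ S q.1 q.2 := by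
  rw [← sum_sum_coverPairs fun V W => totalPairing_ne_zero hf hfc hg hgc hψ, Finset.mul_sum]
  refine Finset.sum_congr rfl fun k hk => ?_
  rw [Finset.mul_sum]
  refine Finset.sum_congr rfl fun i hi => ?_
  have hkmn : k ≤ min m n := Finset.mem_range_succ_iff.1 hk
  have hkm := hkmn.trans (min_le_left _ _)
  have hkn := hkmn.trans (min_le_right _ _)
  have hik := Finset.mem_range_succ_iff.1 hi
  rw [integral_mul_testFn_of_isPathLimit_productKernel hik hkm hkn hf hg (hfg k i hik hkmn)
    (hZ k i hik hkmn) hψ S, ← mul_assoc]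
  congr 1
  rw [mul_assoc]
  exact_mod_cast factorial_mul_choose_mul_choose hkn hkm hik

lemma ae_mul_eq_of_isPathLimit (hf : MemHatL2 n f) (hfc : IsCanonical n f) (hg : MemHatL2 m g)
    (hgc : IsCanonical m g)
    (hfg : ∀ k i : ℕ, i ≤ k → k ≤ min m n →
      MemLp (contraction n m k i f g) 2 (leb (m + n - k - i)))
    (hY : IsPathLimit f Y) (hY' : IsPathLimit g Y')
    (hZ : ∀ k i : ℕ, i ≤ k → k ≤ min m n → IsPathLimit (productKernel n m k i f g) (Z k i)) :
    ∀ᵐ x ∂pathLaw, Y x * Y' x = ∑ k ∈ Finset.range (min m n + 1),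
      (k ! : ℝ) * (m.choose k : ℝ) * (n.choose k : ℝ) *
        ∑ i ∈ Finset.range (k + 1), (k.choose i : ℝ) * Z k i x := by
  set T : Finset (Σ _ : ℕ, ℕ) :=
    (Finset.range (min m n + 1)).sigma fun k => Finset.range (k + 1) with hT
  set c : ℕ → ℕ → ℝ := fun k i => k ! * m.choose k * n.choose k * k.choose i with hc
  have sum_eq (x : ℕ → ℝ) : ∑ k ∈ Finset.range (min m n + 1),
      (k ! : ℝ) * (m.choose k : ℝ) * (n.choose k : ℝ) *
        ∑ i ∈ Finset.range (k + 1), (k.choose i : ℝ) * Z k i x =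
      ∑ q ∈ T, c q.1 q.2 * Z q.1 q.2 x := by
    simp only [hT, hc, Finset.sum_sigma, Finset.mul_sum, mul_assoc]
  have integrable_prod : Integrable (fun x => Y x * Y' x) pathLaw :=
    hY.memLp.integrable_mul hY'.memLp
  have integrable_Z (q) (hq : q ∈ T) : Integrable (Z q.1 q.2) pathLaw := by
    rw [hT, Finset.mem_sigma, Finset.mem_range_succ_iff, Finset.mem_range_succ_iff] at hq
    exact (hZ _ _ hq.2 hq.1).memLp.integrable one_le_two
  have integrable_sum : Integrable (fun x => ∑ q ∈ T, c q.1 q.2 * Z q.1 q.2 x) pathLaw :=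
    integrable_finsetSum _ fun q hq => (integrable_Z q hq).const_mul _
  simp only [sum_eq]
  suffices sub_ae_eq_zero : (fun x => Y x * Y' x - ∑ q ∈ T, c q.1 q.2 * Z q.1 q.2 x)
      =ᵐ[pathLaw] 0 by
    filter_upwards [sub_ae_eq_zero] with x hx using sub_eq_zero.1 hx
  refine ae_eq_zero_of_testFn (integrable_prod.sub integrable_sum) fun ψ hψ S => ?_
  simp only [sub_mul]
  rw [integral_sub (hψ.integrable_mul S integrable_prod) (hψ.integrable_mul S integrable_sum),
    sub_eq_zero, integral_mul_mul_testFn hf hfc hg hgc hψ S hY hY',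
    ← sum_integral_mul_testFn hf hfc hg hgc hfg hZ hψ S]
  simp only [Finset.sum_mul, mul_assoc (c _ _)]
  rw [integral_finsetSum _ fun q hq => (hψ.integrable_mul S (integrable_Z q hq)).const_mul _]
  simp only [integral_const_mul, hT, hc, Finset.sum_sigma]

end Formula

end UniformChaos

end

theorem theorem6p1 {Ω : Type*} [MeasurableSpace Ω] (P : Measure Ω) [IsProbabilityMeasure P]
    (U : ℕ → Ω → ℝ) (hU : UniformChaos.IsIIDUniform P U)
    (n m : ℕ) (f : (Fin n → ℝ) → ℝ) (g : (Fin m → ℝ) → ℝ)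
    (hf : UniformChaos.MemHatL2 n f) (hg : UniformChaos.MemHatL2 m g)
    (hfc : UniformChaos.IsCanonical n f) (hgc : UniformChaos.IsCanonical m g)
    (hfg : ∀ k i : ℕ, i ≤ k → k ≤ min m n →
      MemLp (UniformChaos.contraction n m k i f g) 2 (UniformChaos.leb (m + n - k - i))) :
    -- all the multiple integrals involved are well defined
    UniformChaos.IsMultipleIntegral P U n f (UniformChaos.multipleIntegral P U n f) ∧
    UniformChaos.IsMultipleIntegral P U m g (UniformChaos.multipleIntegral P U m g) ∧
    (∀ k i : ℕ, i ≤ k → k ≤ min m n →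
      UniformChaos.IsMultipleIntegral P U (m + n - k - i)
        (UniformChaos.productKernel n m k i f g)
        (UniformChaos.multipleIntegral P U (m + n - k - i)
          (UniformChaos.productKernel n m k i f g))) ∧
    -- the multiplication formula
    ∀ᵐ ω ∂P,
      UniformChaos.multipleIntegral P U n f ω * UniformChaos.multipleIntegral P U m g ω =
        ∑ k ∈ Finset.range (min m n + 1),
          (k ! : ℝ) * (m.choose k : ℝ) * (n.choose k : ℝ) *
            ∑ i ∈ Finset.range (k + 1), (k.choose i : ℝ) *
              UniformChaos.multipleIntegral P U (m + n - k - i)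
                (UniformChaos.productKernel n m k i f g) ω := by
  have memHatL2_kernel (k i : ℕ) (hik : i ≤ k) (hk : k ≤ min m n) :
      UniformChaos.MemHatL2 (m + n - k - i) (UniformChaos.productKernel n m k i f g) :=
    UniformChaos.memHatL2_indicator_symmetrisation (hfg k i hik hk)
  refine ⟨UniformChaos.isMultipleIntegral_multipleIntegral hU hf,
    UniformChaos.isMultipleIntegral_multipleIntegral hU hg, fun k i hik hk =>
      UniformChaos.isMultipleIntegral_multipleIntegral hU (memHatL2_kernel k i hik hk), ?_⟩
  obtain ⟨Y, hY⟩ := UniformChaos.exists_isPathLimit hf.memLp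
  obtain ⟨Y', hY'⟩ := UniformChaos.exists_isPathLimit hg.memLp
  choose! Z hZ using fun k i hik hk =>
    UniformChaos.exists_isPathLimit (memHatL2_kernel k i hik hk).memLp
  have kernel_integral_eq := ae_all_iff.2 fun k => ae_all_iff.2 fun i => ae_all_iff.2 fun hik =>
    ae_all_iff.2 fun hk =>
      UniformChaos.multipleIntegral_ae_eq hU (memHatL2_kernel k i hik hk) (hZ k i hik hk)
  filter_upwards [UniformChaos.multipleIntegral_ae_eq hU hf hY,
    UniformChaos.multipleIntegral_ae_eq hU hg hY', kernel_integral_eq,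
    (UniformChaos.measurePreserving_jumpTime hU).quasiMeasurePreserving.ae
      (UniformChaos.ae_mul_eq_of_isPathLimit hf hfc hg hgc hfg hY hY' hZ)]
    with ω f_integral_eq g_integral_eq kernel_integral_eq path_formula
  rw [f_integral_eq, g_integral_eq, path_formula]
  refine Finset.sum_congr rfl fun k hk => congrArg _ <| Finset.sum_congr rfl fun i hi => ?_
  rw [kernel_integral_eq k i (Finset.mem_range_succ_iff.1 hi) (Finset.mem_range_succ_iff.1 hk)]
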